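/- **Setting.** Fix a first-order signature of function symbols only, with equality $\approx$ as the only predicate, and an infinite set of variables. Equations are symmetric; a literal is $s\approx t$ or $s\not\approx t$ (generically $s\#t$), $\mathrm{comp}$ is complement, a clause is a finite multiset (disjunction) of implicitly universally quantified literals, and $\models$ is first-order entailment. A closure $C\cdot\sigma$ is a clause with a substitution that is grounding for it. Most general unifiers (mgus) are idempotent and introduce no fresh variables. Let $\prec_T$ be a well-founded rewrite ordering on terms that is total on ground terms and has only finitely many ground terms below each ground term. It is extended to literals through the multisets $\{s,t\}$ for $s\approx t$ and $\{s,s,t,t\}$ for $s\not\approx t$, to clauses by the multiset extension, and literals and clauses are compared with a term $\beta$ through $\{\beta\}$ and $\{\{\beta\}\}$. A trail is a sequence $\Gamma$ of ground literals $L\sigma$, each annotated with a level and a closure $(C\vee L)\cdot\sigma$. A ground literal $K$ is true (false) in $\Gamma$ if $\Gamma\models K$ ($\Gamma\models\mathrm{comp}(K)$), defined if it is true or false, undefined otherwise. A ground clause is true if one of its literals is, false if all are, undefined otherwise. "$\beta$-true/false/defined" means true/false/defined and $\prec_T\beta$; "$\beta$-undefined" means undefined or $\succ_T\beta$. $\mathrm{conv}(\Gamma)$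 is a convergent ground rewrite system, oriented by $\prec_T$, for the congruence generated by the positive equations of $\Gamma$. A trail literal is a decision literal if its level is one more than that of its predecessor (than $0$, if it is the first literal), and a propagated literal otherwise. A core of a defined literal $K$ is a minimal subsequence of $\Gamma$ in which $K$ is defined; the defining literal of $K$ is the last literal of a core whose last literal is earliest. The level of $K$ is its annotation if $K\in\Gamma$, else the level of its defining literal, and $0$ if there is none; the level of a clause is the maximal level of its literals ($0$ for the empty clause). The trail induced ordering $\prec_{\Gamma^*}$ on ground literals is as follows: $\beta$-defined literals precede $\beta$-undefined ones, which are ordered by $\prec_T$; among $\beta$-defined literals, those of level $0$ come first, ordered by $\prec_T$; those of positive level are ordered by the trail position of their defining literal, where at the position of a trail literal $L_i$ the order is $L_i$, then $\mathrm{comp}(L_i)$, then all others by $\prec_T$. It is extended to clauses by the multiset extension. A rewrite inference between variable-disjoint (renamed) closures $(l_1\approx r_1\vee C_1)\cdot\sigma_1$ and $(l_2\#r_2\vee C_2)\cdot\sigma_2$ with $r_1\sigma_1\prec_T l_1\sigma_1$ and $(l_2\#r_2)\sigma_2|_p=l_1\sigma_1$ yields $((l_2\#r_2)\delta[r_1]_p\,\mu\vee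 C_1\mu\vee C_2\delta\mu)\cdot\sigma_1\sigma_2\rho$ with distinguished literal $(l_2\#r_2)\delta[r_1]_p\,\mu$, where $\mu=\mathrm{mgu}((l_2\#r_2)\delta|_p,l_1)$; if $p$ is a position of $l_2\#r_2$, then $\delta$ and $\rho$ are the identity; otherwise $(l_2\#r_2)\delta$ is the most general instance that has position $p$, with $\delta$ acting on the variables of $l_2\#r_2$ and introducing only fresh variables, and $\rho$ is minimal with $(l_2\#r_2)\delta\sigma_2\rho=(l_2\#r_2)\sigma_2$. A reduction chain from a set of closures is a sequence of closures with distinguished literals, each of which is in the set or results from a rewrite inference between earlier ones. A reduction chain application from $\Gamma$ to a closure is a minimal reduction chain from that closure and those on $\Gamma$ whose last distinguished ground literal is the $\mathrm{conv}(\Gamma)$-normal form of the given ground literal. A refutation from $\Gamma$ and a closure whose literal is $\beta$-false in $\Gamma$ is a minimal such chain whose last ground literal is $s\not\approx s$ for some $s$. **The calculus SCL(EQ).** States are tuples $(\Gamma;N;U;\beta;k;D)$, with $N$ and $U$ sets of initial and learned clauses, $\beta$ a ground term, $k$ a level, and $D$ one of $\top$, $\bot$, or a closure. The rules, which leave all components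 that are not mentioned unchanged, are: * *Propagate* ($D=\top$). For $C=C_0\vee C_1\vee L\in N\cup U$ and $\sigma$ grounding for $C$ and irreducible by $\mathrm{conv}(\Gamma)$, with $C_0\sigma$ false in $\Gamma$, all literals of $C_1\sigma$ equal to $L\sigma$, $\mu$ the mgu of $L$ and the literals of $C_1$, $L\sigma$ $\beta$-undefined in $\Gamma$ and $(C_0\vee L)\mu\sigma\prec_T\beta$: append $(s_m\#t_m)\sigma_m$ with level $k$ and closure $(s_m\#t_m\vee C_m)\cdot\sigma_m$, the last element of a reduction chain application from $\Gamma$ to $(L\vee C_0)\mu\cdot\sigma$ with literal $L\mu$. * *Decide* ($D=\top$). For $C=C_0\vee L\in N\cup U$ and $\sigma$ grounding for $C$ and irreducible by $\mathrm{conv}(\Gamma)$, with $C_0\sigma$ $\beta$-undefined or $\beta$-true and $L\sigma$ $\beta$-undefined in $\Gamma$ and $C\sigma\prec_T\beta$: append $(s_m\#t_m)\sigma_m$ with level $k+1$ and closure $(s_m\#t_m\vee\mathrm{comp}(s_m\#t_m))\cdot\sigma_m$, where $s_m\#t_m$ and $\sigma_m$ come from the last element of a reduction chain application from $\Gamma$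 to $(L\vee C_0)\cdot\sigma$; set $k:=k+1$. * *Conflict* ($D=\top$). For $D'\in N\cup U$ and $\sigma$ grounding for $D'$ and irreducible by $\mathrm{conv}(\Gamma)$, with $D'\sigma$ $\beta$-false in $\Gamma$: set $D:=\bot$ if $D'\sigma$ is of level $0$, and $D:=D'\cdot\sigma$ otherwise. * *Skip* ($D=D'\cdot\sigma$, $\Gamma=\Gamma',K,L$ with $K$ of level $l$ and $L$ of level $k$). If $D'\sigma$ is $\beta$-false in $\Gamma',K$: remove $L$ from the trail and set $k:=l$. * *Explore-Refutation* ($D=(D'\vee s\#t)\cdot\sigma$). If $(s\#t)\sigma$ is strictly $\prec_{\Gamma^*}$-maximal in $(D'\vee s\#t)\sigma$ and has the last literal of $\Gamma$ as its defining literal: replace $D$ by a closure $(s_j\#t_j\vee C_j)\cdot\sigma_j$ that occurs in a refutation from $\Gamma$ and $D$ with literal $s\#t$, such that $(s_j\#t_j\vee C_j)\sigma_j\prec_{\Gamma^*}(D'\vee s\#t)\sigma$ and $(s_j\#t_j\vee C_j)\sigma_j$ is $\beta$-false in $\Gamma$. * *Factorize.* Replace $D=(D'\vee L\vee L')\cdot\sigma$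 with $L\sigma=L'\sigma$ by $(D'\vee L)\mu\cdot\sigma$, $\mu=\mathrm{mgu}(L,L')$. * *Equality-Resolution.* Replace $D=(D'\vee s\not\approx s')\cdot\sigma$ with $s\sigma=s'\sigma$ by $D'\mu\cdot\sigma$, $\mu=\mathrm{mgu}(s,s')$. * *Backtrack* ($D=(D'\vee L)\cdot\sigma$, $\Gamma=\Gamma_0,K,\Gamma'$). If $D'\sigma$ is of level $<k$, $K$ is of level $j$, and $\Gamma_0,K$ is the minimal prefix such that some ground instance of $D'\vee L$ is $\beta$-false in $\Gamma_0,K$ but not in $\Gamma_0$: go to $(\Gamma_0;N;U\cup\{D'\vee L\};\beta;j-i;\top)$, where $i=1$ if $K$ is a decision literal and $i=0$ otherwise. * *Grow* ($D=\top$). Go to $(\varepsilon;N;U;\beta';0;\top)$ for a ground term $\beta'$ with $\beta\prec_T\beta'$. A run is a finite sequence of rule applications starting in an initial state $(\varepsilon;N;\emptyset;\beta;0;\top)$, where $N$ is a clause set and $\beta$ a ground term. **Theorem (soundness).** Every state $(\Gamma;N;U;\beta;k;D)$ that results from a run is sound, that is: 1. $\Gamma$ is a consistent sequence of annotated ground literals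 (each annotating substitution is grounding for its clause). 2. For each decomposition $\Gamma=\Gamma_1,L\sigma^{i:(C\vee L)\cdot\sigma},\Gamma_2$ with $L\sigma$ a propagated literal: $C\sigma$ is $\beta$-false in $\Gamma_1$, $L\sigma$ is $\beta$-undefined in $\Gamma_1$ and irreducible by $\mathrm{conv}(\Gamma_1)$, $N\cup U\models C\vee L$, and $(C\vee L)\sigma\prec_T\beta$. 3. For each decomposition $\Gamma=\Gamma_1,L\sigma^{i:(C\vee L)\cdot\sigma},\Gamma_2$ with $L\sigma$ a decision literal: $C=\mathrm{comp}(L)$, $L\sigma$ is $\beta$-undefined in $\Gamma_1$ and irreducible by $\mathrm{conv}(\Gamma_1)$, $N\cup U\models L\vee\mathrm{comp}(L)$, and $(L\vee\mathrm{comp}(L))\sigma\prec_T\beta$. 4. $N\models U$. 5. If $D=C\cdot\sigma$, then $\sigma$ is grounding for $C$, $C\sigma$ is $\beta$-false in $\Gamma$ and $N\cup U\models C$; if $D=\bot$, then $N\cup U\models\bot$. -/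

import Mathlib

universe u v

namespace SCLEQ

/-! ### Terms, positions, substitutions

Terms over the function symbols of `L` and the variables `V` are Mathlib's `L.Term V`. -/

/-- A substitution: a total map from variables to terms. -/
abbrev Subst (L : FirstOrder.Language.{u, 0}) (V : Type v) := V → L.Term V

section Terms

variable {L : FirstOrder.Language.{u, 0}} {V : Type v}

/-- The variables of a term. -/
def vars : L.Term V → Set V
  | .var x => {x}
  | .func _ ts => ⋃ i, vars (ts i)

def IsGround (t : L.Term V) : Prop := vars t = ∅

/-- Composition `στ` of substitutions: first `σ`, then `τ`. -/
def Subst.comp (σ τ : Subst L V) : Subst L V := fun x => (σ x).subst τ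

def Subst.dom (σ : Subst L V) : Set V := {x | σ x ≠ .var x}

open Classical in
/-- The restriction of the domain of `σ` to `X`. -/
noncomputable def Subst.restrict (σ : Subst L V) (X : Set V) : Subst L V :=
  fun x => if x ∈ X then σ x else .var x

/-- `subtermAt p t` is the subterm `t|_p`, or `none` if `p` is not a position of `t`
(arguments are numbered from `0`). -/
def subtermAt : List ℕ → L.Term V → Option (L.Term V)
  | [], t => some t
  | _ :: _, .var _ => none
  | i :: p, @FirstOrder.Language.Term.func _ _ n _ ts => if h : i < n then subtermAt p (ts ⟨i, h⟩) else none

/-- `p` is a position of `t`. -/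
def IsPos (p : List ℕ) (t : L.Term V) : Prop := (subtermAt p t).isSome

/-- `replaceAt p s t` is `t[s]_p` (and `t` itself if `p` is not a position of `t`). -/
def replaceAt : List ℕ → L.Term V → L.Term V → L.Term V
  | [], s, _ => s
  | _ :: _, _, .var x => .var x
  | i :: p, s, @FirstOrder.Language.Term.func _ _ n f ts =>
      if h : i < n then .func f (Function.update ts ⟨i, h⟩ (replaceAt p s (ts ⟨i, h⟩)))
      else .func f ts

/-- `μ` unifies all pairs of terms in `E`. -/
def Unifies (μ : Subst L V) (E : Set (L.Term V × L.Term V)) : Prop :=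
  ∀ e ∈ E, e.1.subst μ = e.2.subst μ

/-- `μ` is a most general unifier of all pairs of terms in `E`; mgus are idempotent and
introduce no fresh variables. -/
structure IsMGU (μ : Subst L V) (E : Set (L.Term V × L.Term V)) : Prop where
  unifies : Unifies μ E
  most_general : ∀ τ : Subst L V, Unifies τ E → ∃ ρ : Subst L V, τ = μ.comp ρ
  idempotent : μ.comp μ = μ
  no_fresh : ∀ x, ∀ y ∈ vars (μ x), y = x ∨ ∃ e ∈ E, y ∈ vars e.1 ∪ vars e.2

/-! ### Rewriting -/

/-- A term rewrite system, as the set of its rules `l → r`. -/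
abbrev TRS (L : FirstOrder.Language.{u, 0}) (V : Type v) := Set (L.Term V × L.Term V)

/-- The one-step rewrite relation of `R`. -/
def Rewrites (R : TRS L V) (s t : L.Term V) : Prop :=
  ∃ rule ∈ R, ∃ (p : List ℕ) (σ : Subst L V),
    subtermAt p s = some (rule.1.subst σ) ∧ t = replaceAt p (rule.2.subst σ) s

def IrreducibleTerm (R : TRS L V) (s : L.Term V) : Prop := ∀ t, ¬ Rewrites R s t

/-- `s` is a normal form of `t` with respect to `R`. -/
def IsNormalForm (R : TRS L V) (t s : L.Term V) : Prop :=
  Relation.ReflTransGen (Rewrites R) t s ∧ IrreducibleTerm R s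

/-- All terms in the codomain of `σ` are irreducible. -/
def IrreducibleSubst (R : TRS L V) (σ : Subst L V) : Prop :=
  ∀ x ∈ σ.dom, IrreducibleTerm R (σ x)

/-- `prec` is a desired term ordering: a well-founded rewrite ordering that is total on ground
terms and has only finitely many ground terms below each ground term. -/
structure IsDesired (prec : L.Term V → L.Term V → Prop) : Prop where
  irrefl : ∀ t, ¬ prec t t
  trans : ∀ s t r, prec s t → prec t r → prec s r
  context : ∀ {n : ℕ} (f : L.Functions n) (ts : Fin n → L.Term V) (i : Fin n) (s t : L.Term V),
    prec s t → prec (.func f (Function.update ts i s)) (.func f (Function.update ts i t))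
  subst : ∀ (σ : Subst L V) (s t : L.Term V), prec s t → prec (s.subst σ) (t.subst σ)
  wf : WellFounded prec
  total : ∀ s t, IsGround s → IsGround t → prec s t ∨ s = t ∨ prec t s
  finite_below : ∀ t, IsGround t → {s | IsGround s ∧ prec s t}.Finite

end Terms

/-- The multiset extension of a relation: `M` is smaller than `M'` if `M` arises from `M'` by
replacing a nonempty submultiset by finitely many elements, each of them smaller than one of the
removed elements. -/
def MulExt {α : Type*} (r : α → α → Prop) (M M' : Multiset α) : Prop :=
  ∃ X Y Z : Multiset α, Z ≠ 0 ∧ M = X + Y ∧ M' = X + Z ∧ ∀ y ∈ Y, ∃ z ∈ Z, r y z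

/-! ### Literals and clauses -/

/-- An equational literal `s ≈ t` (`pos = true`) or `s ≉ t` (`pos = false`). Equations are
symmetric, so the atom is an unordered pair. -/
structure Lit (L : FirstOrder.Language.{u, 0}) (V : Type v) where
  pos : Bool
  atom : Sym2 (L.Term V)

/-- A clause is a finite multiset of literals, read as their disjunction. -/
abbrev Clause (L : FirstOrder.Language.{u, 0}) (V : Type v) := Multiset (Lit L V)

section Literals

variable {L : FirstOrder.Language.{u, 0}} {V : Type v}

/-- The literal `s # t` with the given sign. -/
def mkLit (b : Bool) (s t : L.Term V) : Lit L V := ⟨b, s(s, t)⟩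

/-- The complement of a literal. -/
def Lit.comp (K : Lit L V) : Lit L V := ⟨!K.pos, K.atom⟩

def Lit.subst (K : Lit L V) (σ : Subst L V) : Lit L V := ⟨K.pos, K.atom.map (·.subst σ)⟩

def Lit.vars (K : Lit L V) : Set V := {x | ∃ t ∈ K.atom, x ∈ SCLEQ.vars t}

def Lit.IsGround (K : Lit L V) : Prop := ∀ t ∈ K.atom, SCLEQ.IsGround t

/-- A literal is irreducible if both of its terms are. -/
def Lit.Irreducible (R : TRS L V) (K : Lit L V) : Prop := ∀ t ∈ K.atom, IrreducibleTerm R t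

/-- The multiset `{s, t}` for `s ≈ t` and `{s, s, t, t}` for `s ≉ t`. -/
def Lit.toMS (K : Lit L V) : Multiset (L.Term V) :=
  if K.pos then K.atom.toMultiset else K.atom.toMultiset + K.atom.toMultiset

/-- Truth of a literal in a structure under an assignment. -/
def Lit.Holds {M : Type*} [L.Structure M] (K : Lit L V) (a : V → M) : Prop :=
  if K.pos then (K.atom.map (·.realize a)).IsDiag else ¬ (K.atom.map (·.realize a)).IsDiag

def clauseSubst (C : Clause L V) (σ : Subst L V) : Clause L V := C.map (·.subst σ)

def clauseVars (C : Clause L V) : Set V := {x | ∃ K ∈ C, x ∈ K.vars}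

def clauseGround (C : Clause L V) : Prop := ∀ K ∈ C, K.IsGround

/-- `σ` is grounding for `C`. -/
def Grounding (σ : Subst L V) (C : Clause L V) : Prop := clauseGround (clauseSubst C σ)

/-- The universal closure of `C` holds in `M`. -/
def ModelsClause (M : Type*) [L.Structure M] (C : Clause L V) : Prop :=
  ∀ a : V → M, ∃ K ∈ C, K.Holds a

/-- Semantic entailment `N ⊨ C` (all clauses are implicitly universally quantified). By the
Löwenheim-Skolem theorem, structures in the universe of the signature suffice. -/
def Entails (N : Set (Clause L V)) (C : Clause L V) : Prop :=
  ∀ (M : Type u) [L.Structure M] [Nonempty M], (∀ C' ∈ N, ModelsClause M C') → ModelsClause M C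

/-- Entailment of a literal by a set of (ground) literals. -/
def LitEntails (G : Set (Lit L V)) (K : Lit L V) : Prop :=
  Entails ((fun H => ({H} : Clause L V)) '' G) {K}

/-- A set of (ground) literals is consistent if it has a model. -/
def Consistent (G : Set (Lit L V)) : Prop :=
  ∃ (M : Type u) (_ : L.Structure M) (_ : Nonempty M),
    ∀ K ∈ G, ModelsClause M ({K} : Clause L V)

/-! Truth values of ground literals and clauses with respect to a set `G` of ground literals. -/

def LitTrue (G : Set (Lit L V)) (K : Lit L V) : Prop := LitEntails G K
def LitFalse (G : Set (Lit L V)) (K : Lit L V) : Prop := LitEntails G K.comp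
def LitDefined (G : Set (Lit L V)) (K : Lit L V) : Prop := LitTrue G K ∨ LitFalse G K
def LitUndefined (G : Set (Lit L V)) (K : Lit L V) : Prop := ¬ LitDefined G K

def ClauseTrue (G : Set (Lit L V)) (C : Clause L V) : Prop := ∃ K ∈ C, LitTrue G K
def ClauseFalse (G : Set (Lit L V)) (C : Clause L V) : Prop := ∀ K ∈ C, LitFalse G K
def ClauseUndefined (G : Set (Lit L V)) (C : Clause L V) : Prop :=
  ¬ ClauseTrue G C ∧ ¬ ClauseFalse G C

section Ordering

variable (prec : L.Term V → L.Term V → Prop)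

/-- The term ordering extended to literals. -/
def litPrec (K H : Lit L V) : Prop := MulExt prec K.toMS H.toMS

/-- `K ≺_T β` for a literal `K` and a term `β`. -/
def litBelow (K : Lit L V) (β : L.Term V) : Prop := MulExt prec K.toMS {β}

/-- `C ≺_T β` for a clause `C` and a term `β`. -/
def clauseBelow (C : Clause L V) (β : L.Term V) : Prop :=
  MulExt (MulExt prec) (C.map Lit.toMS) {{β}}

/-- `β ≺_T C` for a clause `C` and a term `β`. -/
def clauseAbove (C : Clause L V) (β : L.Term V) : Prop :=
  MulExt (MulExt prec) {{β}} (C.map Lit.toMS)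

/-! The notions of truth relative to the bound `β`. -/

def LitBUndefined (β : L.Term V) (G : Set (Lit L V)) (K : Lit L V) : Prop :=
  MulExt prec {β} K.toMS ∨ LitUndefined G K
def LitBDefined (β : L.Term V) (G : Set (Lit L V)) (K : Lit L V) : Prop :=
  litBelow prec K β ∧ LitDefined G K
def LitBFalse (β : L.Term V) (G : Set (Lit L V)) (K : Lit L V) : Prop :=
  litBelow prec K β ∧ LitFalse G K

def ClauseBTrue (β : L.Term V) (G : Set (Lit L V)) (C : Clause L V) : Prop :=
  clauseBelow prec C β ∧ ClauseTrue G C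
def ClauseBFalse (β : L.Term V) (G : Set (Lit L V)) (C : Clause L V) : Prop :=
  clauseBelow prec C β ∧ ClauseFalse G C
def ClauseBUndefined (β : L.Term V) (G : Set (Lit L V)) (C : Clause L V) : Prop :=
  clauseAbove prec C β ∨ ClauseUndefined G C

/-- The rewrite system `conv(G)`: all ground rules `l → r` with `r ≺_T l` such that `l ≈ r` follows
from the positive equations in `G`. For a desired ordering it is convergent, and a ground term is
irreducible iff it is the least element of its congruence class. Every convergent system of
rules that are ground, oriented by `≺_T`, and generate the congruence of the positive equations
in `G` has the same irreducible terms and the same normal forms. -/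
def conv (G : Set (Lit L V)) : TRS L V :=
  {rule | IsGround rule.1 ∧ IsGround rule.2 ∧ prec rule.2 rule.1 ∧
    LitEntails {K ∈ G | K.pos = true} (mkLit true rule.1 rule.2)}

/-- `H` is the literal `K` with both terms replaced by their normal forms. -/
def LitNormalForm (R : TRS L V) (K H : Lit L V) : Prop :=
  ∃ s t s' t', K = mkLit K.pos s t ∧ H = mkLit K.pos s' t' ∧
    IsNormalForm R s s' ∧ IsNormalForm R t t'

end Ordering

end Literals

/-! ### Trails -/

/-- A closure `(lit ∨ rest)·subst` with a distinguished literal. -/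
structure LitClosure (L : FirstOrder.Language.{u, 0}) (V : Type v) where
  lit : Lit L V
  rest : Clause L V
  subst : Subst L V

/-- An annotated ground literal: the closure `(lit ∨ rest)·subst` and the level annotate the
ground literal `lit·subst`. -/
structure AnnLit (L : FirstOrder.Language.{u, 0}) (V : Type v) where
  closure : LitClosure L V
  level : ℕ

/-- A sequence of annotated literals, the most recent one last. -/
abbrev Trail (L : FirstOrder.Language.{u, 0}) (V : Type v) := List (AnnLit L V)

section Trails

variable {L : FirstOrder.Language.{u, 0}} {V : Type v}

/-- The clause `lit ∨ rest`. -/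
def LitClosure.clause (c : LitClosure L V) : Clause L V := c.lit ::ₘ c.rest

/-- The distinguished literal after instantiation. -/
def LitClosure.inst (c : LitClosure L V) : Lit L V := c.lit.subst c.subst

def LitClosure.vars (c : LitClosure L V) : Set V := clauseVars c.clause

/-- Renaming of variables in a closure; the ground instance does not change. -/
def LitClosure.rename (c : LitClosure L V) (ρ : Equiv.Perm V) : LitClosure L V where
  lit := c.lit.subst (fun x => .var (ρ x))
  rest := clauseSubst c.rest (fun x => .var (ρ x))
  subst := fun x => c.subst (ρ.symm x)

def AnnLit.inst (e : AnnLit L V) : Lit L V := e.closure.inst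

/-- The set of ground literals of a trail. -/
def lits (Γ : Trail L V) : Set (Lit L V) := {K | ∃ e ∈ Γ, e.inst = K}

/-- The level of the last literal of a trail, which is `0` for the empty trail. -/
def lastLevel (Γ : Trail L V) : ℕ := (Γ.getLast?.map AnnLit.level).getD 0

/-- The entry `e` following the trail prefix `Γ` is a decision literal: its level is one more than
the level before. All other entries are propagated literals. -/
def IsDecision (Γ : Trail L V) (e : AnnLit L V) : Prop := e.level = lastLevel Γ + 1

/-- The literals of the subsequence of `Γ` given by a set of indices. -/
def subLits (Γ : Trail L V) (S : Set (Fin Γ.length)) : Set (Lit L V) :=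
  {K | ∃ i ∈ S, (Γ.get i).inst = K}

/-- The subsequence given by `S` is a core of `K`: a minimal one in which `K` is defined. -/
def IsCore (Γ : Trail L V) (K : Lit L V) (S : Set (Fin Γ.length)) : Prop :=
  LitDefined (subLits Γ S) K ∧ ∀ S', S' ⊂ S → ¬ LitDefined (subLits Γ S') K

/-- The `i`-th literal of `Γ` is the defining literal of `K`: it is the greatest literal of some
core of `K`, and the greatest literal of every core of `K` is at least as great. -/
def IsDefining (Γ : Trail L V) (K : Lit L V) (i : Fin Γ.length) : Prop :=
  ∃ S, IsCore Γ K S ∧ IsGreatest S i ∧ ∀ S', IsCore Γ K S' → ∃ j, IsGreatest S' j ∧ i ≤ j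

/-- The ground literal `K` is of level `n` in `Γ`. -/
def LitLevel (Γ : Trail L V) (K : Lit L V) (n : ℕ) : Prop :=
  (∃ e ∈ Γ, e.inst = K ∧ e.level = n) ∨
  (K ∉ lits Γ ∧ LitDefined (lits Γ) K ∧
    ((∃ i, IsDefining Γ K i ∧ (Γ.get i).level = n) ∨
      ((¬ ∃ i, IsDefining Γ K i) ∧ n = 0)))

/-- The ground clause `C` is of level `n`: the maximal level of its literals is `n` (and the
empty clause is of level `0`). -/
def ClauseLevel (Γ : Trail L V) (C : Clause L V) (n : ℕ) : Prop :=
  (∀ K ∈ C, ∃ m ≤ n, LitLevel Γ K m) ∧ (n = 0 ∨ ∃ K ∈ C, LitLevel Γ K n)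

/-! ### The trail induced ordering -/

variable (prec : L.Term V → L.Term V → Prop)

/-- `K` is one of the literals `M_{i,j}`: a `β`-defined ground literal with `i`-th trail literal as
defining literal such that neither it nor its complement is on the trail. -/
def IsImplied (β : L.Term V) (Γ : Trail L V) (K : Lit L V) (i : Fin Γ.length) : Prop :=
  K.IsGround ∧ LitBDefined prec β (lits Γ) K ∧ K ∉ lits Γ ∧ K.comp ∉ lits Γ ∧ IsDefining Γ K i

def PosLevel (Γ : Trail L V) (K : Lit L V) : Prop := ∃ n, 0 < n ∧ LitLevel Γ K n

/-- The trail induced ordering on ground literals. -/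
inductive TrailPrec (β : L.Term V) (Γ : Trail L V) : Lit L V → Lit L V → Prop
  | implied_implied {K H : Lit L V} {i k : Fin Γ.length} :
      PosLevel Γ K → PosLevel Γ H → IsImplied prec β Γ K i → IsImplied prec β Γ H k →
      (i < k ∨ (i = k ∧ litPrec prec K H)) → TrailPrec β Γ K H
  | lit_lit {i j : Fin Γ.length} :
      PosLevel Γ (Γ.get i).inst → PosLevel Γ (Γ.get j).inst → i < j →
      TrailPrec β Γ (Γ.get i).inst (Γ.get j).inst
  | comp_lit {i j : Fin Γ.length} :
      PosLevel Γ (Γ.get i).inst.comp → PosLevel Γ (Γ.get j).inst → i < j →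
      TrailPrec β Γ (Γ.get i).inst.comp (Γ.get j).inst
  | lit_comp {i j : Fin Γ.length} :
      PosLevel Γ (Γ.get i).inst → PosLevel Γ (Γ.get j).inst.comp → i ≤ j →
      TrailPrec β Γ (Γ.get i).inst (Γ.get j).inst.comp
  | comp_comp {i j : Fin Γ.length} :
      PosLevel Γ (Γ.get i).inst.comp → PosLevel Γ (Γ.get j).inst.comp → i < j →
      TrailPrec β Γ (Γ.get i).inst.comp (Γ.get j).inst.comp
  | lit_implied {K : Lit L V} {i k : Fin Γ.length} :
      PosLevel Γ (Γ.get i).inst → PosLevel Γ K → IsImplied prec β Γ K k → i ≤ k →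
      TrailPrec β Γ (Γ.get i).inst K
  | comp_implied {K : Lit L V} {i k : Fin Γ.length} :
      PosLevel Γ (Γ.get i).inst.comp → PosLevel Γ K → IsImplied prec β Γ K k → i ≤ k →
      TrailPrec β Γ (Γ.get i).inst.comp K
  | implied_lit {K : Lit L V} {i k : Fin Γ.length} :
      PosLevel Γ K → PosLevel Γ (Γ.get i).inst → IsImplied prec β Γ K k → k < i →
      TrailPrec β Γ K (Γ.get i).inst
  | implied_comp {K : Lit L V} {i k : Fin Γ.length} :
      PosLevel Γ K → PosLevel Γ (Γ.get i).inst.comp → IsImplied prec β Γ K k → k < i →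
      TrailPrec β Γ K (Γ.get i).inst.comp
  | zero_zero {K H : Lit L V} : K.IsGround → H.IsGround →
      LitBDefined prec β (lits Γ) K → LitBDefined prec β (lits Γ) H →
      LitLevel Γ K 0 → LitLevel Γ H 0 → litPrec prec K H → TrailPrec β Γ K H
  | zero_pos {K H : Lit L V} : K.IsGround → H.IsGround →
      LitBDefined prec β (lits Γ) K → LitBDefined prec β (lits Γ) H →
      LitLevel Γ K 0 → PosLevel Γ H → TrailPrec β Γ K H
  | undef_undef {K H : Lit L V} : K.IsGround → H.IsGround →
      LitBUndefined prec β (lits Γ) K → LitBUndefined prec β (lits Γ) H →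
      litPrec prec K H → TrailPrec β Γ K H
  | def_undef {K H : Lit L V} : K.IsGround → H.IsGround →
      LitBDefined prec β (lits Γ) K → LitBUndefined prec β (lits Γ) H → TrailPrec β Γ K H

/-! ### Rewrite inferences, reduction chains, refutations -/

/-- `out` is the closure that results from a rewrite inference with the variable disjoint closures
`c₁ = (l₁ ≈ r₁ ∨ C₁)·σ₁` and `c₂ = (l₂ # r₂ ∨ C₂)·σ₂` at position `p`. Since equations are unordered
pairs, the side of the second literal that contains `p` may be called `l₂`. As usual for closures,
the domains of `σ₁` and `σ₂` are restricted to the variables of their clauses before composing them.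

In the first alternative `p` is a position of `l₂`. In the second one it lies below a variable, and
`l₂ # r₂` is first instantiated by the most general `δ` that makes `p` a position and introduces only
fresh variables; `ρ` grounds the fresh variables. -/
def DisjointRewriteInference (c₁ c₂ : LitClosure L V) (p : List ℕ) (out : LitClosure L V) : Prop :=
  ∃ (b : Bool) (l₁ r₁ l₂ r₂ s : L.Term V) (δ ρ μ : Subst L V),
    c₁.lit = mkLit true l₁ r₁ ∧ c₂.lit = mkLit b l₂ r₂ ∧
    Disjoint c₁.vars c₂.vars ∧
    prec (r₁.subst c₁.subst) (l₁.subst c₁.subst) ∧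
    subtermAt p (l₂.subst c₂.subst) = some (l₁.subst c₁.subst) ∧
    (let σ₁ := c₁.subst.restrict c₁.vars
     let σ₂ := c₂.subst.restrict c₂.vars
     let IsInstance (δ' ρ' : Subst L V) : Prop := IsPos p (l₂.subst δ') ∧
       ((l₂.subst δ').subst σ₂).subst ρ' = l₂.subst σ₂ ∧
       ((r₂.subst δ').subst σ₂).subst ρ' = r₂.subst σ₂
     ((IsPos p l₂ ∧ δ = (fun x => .var x) ∧ ρ = (fun x => .var x)) ∨
       (¬ IsPos p l₂ ∧ δ.dom ⊆ vars l₂ ∪ vars r₂ ∧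
        (∀ x ∈ δ.dom, Disjoint (vars (δ x)) (c₁.vars ∪ c₂.vars)) ∧
        IsInstance δ ρ ∧
        (∀ ρ', IsInstance δ ρ' → ρ.dom ⊆ ρ'.dom) ∧
        (∀ δ' ρ', IsInstance δ' ρ' →
          ∃ τ : Subst L V, (l₂.subst δ).subst τ = l₂.subst δ' ∧
            (r₂.subst δ).subst τ = r₂.subst δ'))) ∧
     subtermAt p (l₂.subst δ) = some s ∧ IsMGU μ {(s, l₁)} ∧
     out.lit = mkLit b ((replaceAt p r₁ (l₂.subst δ)).subst μ) ((r₂.subst δ).subst μ) ∧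
     out.rest = clauseSubst c₁.rest μ + clauseSubst (clauseSubst c₂.rest δ) μ ∧
     out.subst = (σ₁.comp σ₂).comp ρ)

/-- A rewrite inference; its premises are first made variable disjoint by renaming. -/
def RewriteInference (c₁ c₂ : LitClosure L V) (p : List ℕ) (out : LitClosure L V) : Prop :=
  ∃ ρ₁ ρ₂ : Equiv.Perm V, DisjointRewriteInference prec (c₁.rename ρ₁) (c₂.rename ρ₂) p out

end Trails

/-- A rewrite step: a closure with a distinguished literal, together with either no premises or two
premises and a position. -/
inductive RewriteStep (L : FirstOrder.Language.{u, 0}) (V : Type v) : Type (max u v)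
  | leaf (c : LitClosure L V) : RewriteStep L V
  | infer (c : LitClosure L V) (R S : RewriteStep L V) (p : List ℕ) : RewriteStep L V

section Chains

variable {L : FirstOrder.Language.{u, 0}} {V : Type v}

def RewriteStep.closure : RewriteStep L V → LitClosure L V
  | .leaf c => c
  | .infer c _ _ _ => c

variable (prec : L.Term V → L.Term V → Prop)

/-- A rewrite step is an available closure or results from a rewrite inference with previous
rewrite steps. -/
def RewriteStep.Justified (avail : Set (LitClosure L V)) (previous : List (RewriteStep L V)) :
    RewriteStep L V → Prop
  | .leaf c => c ∈ avail
  | .infer c R S p => R ∈ previous ∧ S ∈ previous ∧ RewriteInference prec R.closure S.closure p c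

/-- A reduction chain from the closures in `avail`. -/
def ReductionChain (avail : Set (LitClosure L V)) (P : List (RewriteStep L V)) : Prop :=
  ∀ P₁ I P₂, P = P₁ ++ I :: P₂ → I.Justified prec avail P₁

/-- The closures annotated on `Γ`, and `c`. -/
def available (Γ : Trail L V) (c : LitClosure L V) : Set (LitClosure L V) :=
  {c' | c' = c ∨ ∃ e ∈ Γ, e.closure = c'}

/-- A reduction chain from `Γ, c` whose last literal is the `conv(Γ)`-normal form of the literal
of `c`. -/
def ReducesLit (Γ : Trail L V) (c : LitClosure L V) (P : List (RewriteStep L V)) : Prop :=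
  ReductionChain prec (available Γ c) P ∧
  ∃ I, P.getLast? = some I ∧ LitNormalForm (conv prec (lits Γ)) c.inst I.closure.inst

/-- A (minimal) reduction chain application from `Γ` to the literal of `c`. -/
def ReductionChainApplication (Γ : Trail L V) (c : LitClosure L V)
    (P : List (RewriteStep L V)) : Prop :=
  ReducesLit prec Γ c P ∧ ∀ i < P.length, ¬ ReducesLit prec Γ c (P.eraseIdx i)

/-- A reduction chain from `Γ, c` whose last literal has the ground instance `s ≉ s`. -/
def RefutesLit (Γ : Trail L V) (c : LitClosure L V) (P : List (RewriteStep L V)) : Prop :=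
  ReductionChain prec (available Γ c) P ∧
  ∃ I, P.getLast? = some I ∧ ∃ s, I.closure.inst = mkLit false s s

/-- A (minimal) refutation from `Γ` and the literal of `c`, which must be `β`-false in `Γ`. -/
def Refutation (β : L.Term V) (Γ : Trail L V) (c : LitClosure L V)
    (P : List (RewriteStep L V)) : Prop :=
  LitBFalse prec β (lits Γ) c.inst ∧ RefutesLit prec Γ c P ∧
  ∀ i, i + 1 < P.length → ¬ RefutesLit prec Γ c (P.eraseIdx i)

end Chains

/-! ### The calculus -/

/-- The last component of a state: `⊤`, `⊥` or a closure `C·σ`. -/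
inductive Status (L : FirstOrder.Language.{u, 0}) (V : Type v) : Type (max u v)
  | top : Status L V
  | bot : Status L V
  | conflict (C : Clause L V) (σ : Subst L V) : Status L V

/-- A state `(Γ; N; U; β; k; D)`. -/
structure State (L : FirstOrder.Language.{u, 0}) (V : Type v) where
  Γ : Trail L V
  N : Set (Clause L V)
  U : Set (Clause L V)
  β : L.Term V
  k : ℕ
  D : Status L V

section Calculus

variable {L : FirstOrder.Language.{u, 0}} {V : Type v} (prec : L.Term V → L.Term V → Prop)

/-- Some ground instance of `C` is `β`-false in `Γ, K` but not in `Γ`. -/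
def BecomesFalse (β : L.Term V) (C : Clause L V) (Γ : Trail L V) (K : AnnLit L V) : Prop :=
  ∃ τ : Subst L V, Grounding τ C ∧ ClauseBFalse prec β (lits (Γ ++ [K])) (clauseSubst C τ) ∧
    ¬ ClauseBFalse prec β (lits Γ) (clauseSubst C τ)

/-- The rules of the calculus. In `propagate`, the literals of `C₁` and the literal `K` are given as
equations `q.1 # q.2` and `s # t`, so that `μ` is a most general unifier of them all. In
`exploreRefutation`, the whole trail `Γ` of the state is used, and its last literal is the defining
literal of `K·σ`. -/
inductive Step : State L V → State L V → Prop
  | propagate {Γ : Trail L V} {N U : Set (Clause L V)} {β : L.Term V} {k : ℕ}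
      {C C₀ C₁ : Clause L V} {K : Lit L V} {σ μ : Subst L V} {b : Bool} {s t : L.Term V}
      {Q : Multiset (L.Term V × L.Term V)} {P : List (RewriteStep L V)} {I : RewriteStep L V} :
      C ∈ N ∪ U → Grounding σ C → C = C₀ + C₁ + {K} →
      ClauseFalse (lits Γ) (clauseSubst C₀ σ) →
      K = mkLit b s t → C₁ = Q.map (fun q => mkLit b q.1 q.2) →
      (∀ q ∈ Q, q.1.subst σ = s.subst σ ∧ q.2.subst σ = t.subst σ) →
      IsMGU μ {e | ∃ q ∈ Q, e = (q.1, s) ∨ e = (q.2, t)} →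
      LitBUndefined prec β (lits Γ) (K.subst σ) →
      clauseBelow prec (clauseSubst (clauseSubst (C₀ + {K}) μ) σ) β →
      IrreducibleSubst (conv prec (lits Γ)) σ →
      ReductionChainApplication prec Γ ⟨K.subst μ, clauseSubst C₀ μ, σ⟩ P →
      P.getLast? = some I →
      Step ⟨Γ, N, U, β, k, .top⟩ ⟨Γ ++ [⟨I.closure, k⟩], N, U, β, k, .top⟩
  | decide {Γ : Trail L V} {N U : Set (Clause L V)} {β : L.Term V} {k : ℕ}
      {C C₀ : Clause L V} {K : Lit L V} {σ : Subst L V}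
      {P : List (RewriteStep L V)} {I : RewriteStep L V} :
      C ∈ N ∪ U → Grounding σ C → C = C₀ + {K} →
      (ClauseBUndefined prec β (lits Γ) (clauseSubst C₀ σ) ∨
        ClauseBTrue prec β (lits Γ) (clauseSubst C₀ σ)) →
      LitBUndefined prec β (lits Γ) (K.subst σ) →
      clauseBelow prec (clauseSubst (C₀ + {K}) σ) β →
      IrreducibleSubst (conv prec (lits Γ)) σ →
      ReductionChainApplication prec Γ ⟨K, C₀, σ⟩ P →
      P.getLast? = some I →
      Step ⟨Γ, N, U, β, k, .top⟩
        ⟨Γ ++ [⟨⟨I.closure.lit, {I.closure.lit.comp}, I.closure.subst⟩, k + 1⟩],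
          N, U, β, k + 1, .top⟩
  | conflictBot {Γ : Trail L V} {N U : Set (Clause L V)} {β : L.Term V} {k : ℕ}
      {C : Clause L V} {σ : Subst L V} :
      C ∈ N ∪ U → Grounding σ C → ClauseBFalse prec β (lits Γ) (clauseSubst C σ) →
      IrreducibleSubst (conv prec (lits Γ)) σ → ClauseLevel Γ (clauseSubst C σ) 0 →
      Step ⟨Γ, N, U, β, k, .top⟩ ⟨Γ, N, U, β, k, .bot⟩
  | conflict {Γ : Trail L V} {N U : Set (Clause L V)} {β : L.Term V} {k : ℕ}
      {C : Clause L V} {σ : Subst L V} :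
      C ∈ N ∪ U → Grounding σ C → ClauseBFalse prec β (lits Γ) (clauseSubst C σ) →
      IrreducibleSubst (conv prec (lits Γ)) σ → ¬ ClauseLevel Γ (clauseSubst C σ) 0 →
      Step ⟨Γ, N, U, β, k, .top⟩ ⟨Γ, N, U, β, k, .conflict C σ⟩
  | skip {Γ : Trail L V} {N U : Set (Clause L V)} {β : L.Term V} {k : ℕ}
      {C : Clause L V} {σ : Subst L V} {e e' : AnnLit L V} :
      e'.level = k → ClauseBFalse prec β (lits (Γ ++ [e])) (clauseSubst C σ) →
      Step ⟨Γ ++ [e, e'], N, U, β, k, .conflict C σ⟩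
        ⟨Γ ++ [e], N, U, β, e.level, .conflict C σ⟩
  | exploreRefutation {Γ : Trail L V} {N U : Set (Clause L V)} {β : L.Term V} {k : ℕ}
      {C : Clause L V} {K : Lit L V} {σ : Subst L V} {i : Fin Γ.length}
      {P : List (RewriteStep L V)} {I : RewriteStep L V} :
      (∀ H ∈ clauseSubst C σ, H ≠ K.subst σ ∧ ¬ TrailPrec prec β Γ (K.subst σ) H) →
      i.val + 1 = Γ.length → IsDefining Γ (K.subst σ) i →
      Refutation prec β Γ ⟨K, C, σ⟩ P → I ∈ P →
      MulExt (TrailPrec prec β Γ) (clauseSubst I.closure.clause I.closure.subst)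
        (clauseSubst (C + {K}) σ) →
      ClauseBFalse prec β (lits Γ) (clauseSubst I.closure.clause I.closure.subst) →
      Step ⟨Γ, N, U, β, k, .conflict (C + {K}) σ⟩
        ⟨Γ, N, U, β, k, .conflict I.closure.clause I.closure.subst⟩
  | factorize {Γ : Trail L V} {N U : Set (Clause L V)} {β : L.Term V} {k : ℕ}
      {C : Clause L V} {σ μ : Subst L V} {b : Bool} {s t s' t' : L.Term V} :
      s.subst σ = s'.subst σ → t.subst σ = t'.subst σ → IsMGU μ {(s, s'), (t, t')} →
      Step ⟨Γ, N, U, β, k, .conflict (C + {mkLit b s t} + {mkLit b s' t'}) σ⟩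
        ⟨Γ, N, U, β, k, .conflict (clauseSubst (C + {mkLit b s t}) μ) σ⟩
  | equalityResolution {Γ : Trail L V} {N U : Set (Clause L V)} {β : L.Term V} {k : ℕ}
      {C : Clause L V} {σ μ : Subst L V} {s s' : L.Term V} :
      s.subst σ = s'.subst σ → IsMGU μ {(s, s')} →
      Step ⟨Γ, N, U, β, k, .conflict (C + {mkLit false s s'}) σ⟩
        ⟨Γ, N, U, β, k, .conflict (clauseSubst C μ) σ⟩
  | backtrack {Γ Γ' : Trail L V} {K : AnnLit L V} {N U : Set (Clause L V)} {β : L.Term V}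
      {k k' m : ℕ} {C : Clause L V} {H : Lit L V} {σ : Subst L V} :
      ClauseLevel (Γ ++ K :: Γ') (clauseSubst C σ) m → m < k →
      BecomesFalse prec β (C + {H}) Γ K →
      (∀ Γ₀ K₀ Γ₁, Γ ++ [K] = Γ₀ ++ K₀ :: Γ₁ → BecomesFalse prec β (C + {H}) Γ₀ K₀ → Γ₁ = []) →
      ((IsDecision Γ K ∧ k' + 1 = K.level) ∨ (¬ IsDecision Γ K ∧ k' = K.level)) →
      Step ⟨Γ ++ K :: Γ', N, U, β, k, .conflict (C + {H}) σ⟩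
        ⟨Γ, N, U ∪ {C + {H}}, β, k', .top⟩
  | grow {Γ : Trail L V} {N U : Set (Clause L V)} {β β' : L.Term V} {k : ℕ} :
      IsGround β' → prec β β' →
      Step ⟨Γ, N, U, β, k, .top⟩ ⟨[], N, U, β', 0, .top⟩

/-- The initial state `(ε; N; ∅; β; 0; ⊤)`. -/
def initialState (N : Set (Clause L V)) (β : L.Term V) : State L V := ⟨[], N, ∅, β, 0, .top⟩

/-- `S` results from a run, that is, from a finite sequence of rule applications starting in the
initial state. -/
def ResultsFromRun (N : Set (Clause L V)) (β : L.Term V) (S : State L V) : Prop :=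
  Relation.ReflTransGen (Step prec) (initialState N β) S

/-- Soundness of a state. -/
structure Sound (S : State L V) : Prop where
  consistent : Consistent (lits S.Γ)
  grounding : ∀ e ∈ S.Γ, Grounding e.closure.subst e.closure.clause
  propagated : ∀ Γ₁ e Γ₂, S.Γ = Γ₁ ++ e :: Γ₂ → ¬ IsDecision Γ₁ e →
    ClauseBFalse prec S.β (lits Γ₁) (clauseSubst e.closure.rest e.closure.subst) ∧
    LitBUndefined prec S.β (lits Γ₁) e.inst ∧
    e.inst.Irreducible (conv prec (lits Γ₁)) ∧
    Entails (S.N ∪ S.U) e.closure.clause ∧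
    clauseBelow prec (clauseSubst e.closure.clause e.closure.subst) S.β
  decision : ∀ Γ₁ e Γ₂, S.Γ = Γ₁ ++ e :: Γ₂ → IsDecision Γ₁ e →
    e.closure.rest = {e.closure.lit.comp} ∧
    LitBUndefined prec S.β (lits Γ₁) e.inst ∧
    e.inst.Irreducible (conv prec (lits Γ₁)) ∧
    Entails (S.N ∪ S.U) e.closure.clause ∧
    clauseBelow prec (clauseSubst e.closure.clause e.closure.subst) S.β
  learned : ∀ C ∈ S.U, Entails S.N C
  conflict : ∀ C σ, S.D = .conflict C σ →
    Grounding σ C ∧ ClauseBFalse prec S.β (lits S.Γ) (clauseSubst C σ) ∧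
    Entails (S.N ∪ S.U) C
  bot : S.D = .bot → Entails (S.N ∪ S.U) 0

end Calculus

end SCLEQ

/-!
A rewrite inference unifies its premises, but it also records the ground substitution of each
premise. Since an idempotent most general unifier `μ` satisfies `μσ = σ` for every unifier `σ`, both
premises can be specialized, without changing their ground instances, until the conclusion arises by
replacing a term `l` by a term `r` and all three closures share one substitution. On the ground
level `r ≺ l`, so that entailment by the clauses, the bound `β` and the falsity of the remaining
literals pass from the premises to the conclusion, and hence along reduction chains and
refutations.

A literal and its normal form with respect to `conv(Γ)` are equivalent in all models of `Γ`. The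
normal form of an undefined literal is therefore undefined, and appending it keeps the trail
consistent.

A level-0 conflict yields `⊥` because of two facts not mentioned in the notion of a sound state:
a propagated literal keeps the level of its predecessor, and `k` is the level of the last trail
literal. Thus levels never decrease along the trail, the entries of level 0 are propagated at the
beginning of the trail, and by induction their literals are consequences of `N ∪ U`.
-/

namespace SCLEQ

open FirstOrder.Language

section Terms

variable {L : FirstOrder.Language.{u, 0}} {V : Type v}

theorem subst_subst (t : L.Term V) (σ τ : Subst L V) :
    (t.subst σ).subst τ = t.subst (σ.comp τ) := by
  induction t with
  | var x => rfl
  | func f ts ih => simp [Term.subst, ih]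

theorem subst_var (t : L.Term V) : t.subst (fun x => Term.var x) = t := by
  induction t with
  | var x => rfl
  | func f ts ih => simp [Term.subst, ih]

theorem Subst.comp_assoc (σ τ ρ : Subst L V) : (σ.comp τ).comp ρ = σ.comp (τ.comp ρ) :=
  funext fun x => subst_subst (σ x) τ ρ

theorem mem_vars_func {n : ℕ} {f : L.Functions n} {ts : Fin n → L.Term V} {x : V} :
    x ∈ vars (Term.func f ts) ↔ ∃ i, x ∈ vars (ts i) := by
  simp [vars]

theorem subst_eq_subst_iff {t : L.Term V} {σ τ : Subst L V} :
    t.subst σ = t.subst τ ↔ Set.EqOn σ τ (vars t) := by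
  induction t with
  | var x => simp [vars, Term.subst]
  | func f ts ih =>
    simp only [Term.subst, Term.func.injEq, heq_eq_eq, true_and, funext_iff, ih]
    exact ⟨fun h x hx => (mem_vars_func.1 hx).elim fun i hi => h i hi,
      fun h i x hx => h (mem_vars_func.2 ⟨i, hx⟩)⟩

theorem realize_congr {M : Type*} [L.Structure M] {t : L.Term V} {a b : V → M}
    (h : Set.EqOn a b (vars t)) : t.realize a = t.realize b := by
  induction t with
  | var x => exact h rfl
  | func f ts ih =>
    simp only [Term.realize_func]
    congr 1
    funext i
    exact ih i fun x hx => h (mem_vars_func.2 ⟨i, hx⟩)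

theorem isGround_func {n : ℕ} {f : L.Functions n} {ts : Fin n → L.Term V} :
    IsGround (Term.func f ts) ↔ ∀ i, IsGround (ts i) :=
  Set.iUnion_eq_empty

theorem isGround_subst {t : L.Term V} {σ : Subst L V} :
    IsGround (t.subst σ) ↔ ∀ x ∈ vars t, IsGround (σ x) := by
  induction t with
  | var x => simp [vars, Term.subst]
  | func f ts ih =>
    simp only [Term.subst, isGround_func, ih, mem_vars_func]
    exact ⟨fun h x ⟨i, hx⟩ => h i x hx, fun h i x hx => h x ⟨i, hx⟩⟩

theorem IsGround.subst_eq {t : L.Term V} (h : IsGround t) (σ : Subst L V) : t.subst σ = t := by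
  conv_rhs => rw [← subst_var t]
  rw [subst_eq_subst_iff, h]
  exact Set.eqOn_empty σ _

theorem IsMGU.comp_eq {μ τ : Subst L V} {E : Set (L.Term V × L.Term V)} (h : IsMGU μ E)
    (hτ : Unifies τ E) : μ.comp τ = τ := by
  obtain ⟨ρ, rfl⟩ := h.most_general τ hτ
  rw [← Subst.comp_assoc, h.idempotent]

theorem Subst.restrict_comp_eqOn {σ : Subst L V} {X : Set V} (hσ : ∀ x ∈ X, IsGround (σ x))
    (τ : Subst L V) : Set.EqOn ((σ.restrict X).comp τ) σ X := fun x hx => by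
  simp only [Subst.comp, Subst.restrict, if_pos hx, (hσ x hx).subst_eq]

theorem subst_restrict_comp_of_disjoint {t : L.Term V} {X : Set V} (h : Disjoint (vars t) X)
    (σ τ : Subst L V) : t.subst ((σ.restrict X).comp τ) = t.subst τ :=
  subst_eq_subst_iff.2 fun x hx => by
    simp only [Subst.comp, Subst.restrict, if_neg (Set.disjoint_left.1 h hx), Term.subst]

theorem Subst.comp_restrict_comp_eqOn {δ ρ σ : Subst L V} {X : Set V}
    (hσ : ∀ x ∈ X, IsGround (σ x))
    (hδ : Set.EqOn (δ.comp ((σ.restrict X).comp ρ)) (σ.restrict X) δ.dom) :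
    Set.EqOn (δ.comp ((σ.restrict X).comp ρ)) σ X := by
  intro x hx
  by_cases hxδ : x ∈ δ.dom
  · rw [hδ hxδ, Subst.restrict, if_pos hx]
  · have hδx : δ x = .var x := not_not.1 hxδ
    rw [Subst.comp, hδx, Term.subst, Subst.restrict_comp_eqOn hσ ρ hx]

section Positions

theorem subtermAt_cons_func {n : ℕ} (f : L.Functions n) (ts : Fin n → L.Term V) (i : Fin n)
    (p : List ℕ) : subtermAt (i :: p) (Term.func f ts) = subtermAt p (ts i) := by
  simp [subtermAt]

theorem replaceAt_cons_func {n : ℕ} (f : L.Functions n) (ts : Fin n → L.Term V) (i : Fin n)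
    (p : List ℕ) (r : L.Term V) :
    replaceAt (i :: p) r (Term.func f ts) =
      .func f (Function.update ts i (replaceAt p r (ts i))) := by
  simp [replaceAt]

theorem subtermAt_induction {s : L.Term V}
    {motive : (p : List ℕ) → (t : L.Term V) → subtermAt p t = some s → Prop}
    (nil : motive [] s rfl)
    (cons : ∀ {n : ℕ} (f : L.Functions n) (ts : Fin n → L.Term V) (i : Fin n) (p : List ℕ)
      (h : subtermAt p (ts i) = some s), motive p (ts i) h →
      motive (i :: p) (.func f ts) ((subtermAt_cons_func f ts i p).trans h))
    {p : List ℕ} {t : L.Term V} (h : subtermAt p t = some s) : motive p t h := by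
  induction p generalizing t with
  | nil =>
    obtain rfl : t = s := Option.some.inj h
    exact nil
  | cons i p ih =>
    cases t with
    | var x => simp [subtermAt] at h
    | @func n f ts =>
      have hi : i < n := by
        by_contra hi
        simp [subtermAt, hi] at h
      exact cons f ts ⟨i, hi⟩ p _ (ih ((subtermAt_cons_func f ts ⟨i, hi⟩ p).symm.trans h))

theorem subtermAt_subst {p : List ℕ} {t s : L.Term V} (h : subtermAt p t = some s)
    (σ : Subst L V) : subtermAt p (t.subst σ) = some (s.subst σ) := by
  induction h using subtermAt_induction with
  | nil => rfl
  | cons f ts i p _ ih => rwa [Term.subst, subtermAt_cons_func]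

theorem replaceAt_subst {p : List ℕ} {t s : L.Term V} (h : subtermAt p t = some s)
    (r : L.Term V) (σ : Subst L V) :
    (replaceAt p r t).subst σ = replaceAt p (r.subst σ) (t.subst σ) := by
  induction h using subtermAt_induction with
  | nil => rfl
  | cons f ts i p _ ih =>
    simp only [Term.subst, replaceAt_cons_func, ← ih]
    congr 1
    funext j
    exact Function.apply_update (fun _ t => t.subst σ) ts i _ j

/-- The relation `R` is closed under contexts: it is preserved by replacing an argument of a
function symbol. Iterating this gives all contexts, see `ContextClosed.replaceAt`. -/
def ContextClosed (R : L.Term V → L.Term V → Prop) : Prop :=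
  ∀ ⦃n : ℕ⦄ (f : L.Functions n) (ts : Fin n → L.Term V) (i : Fin n) (s t : L.Term V),
    R s t → R (.func f (Function.update ts i s)) (.func f (Function.update ts i t))

theorem ContextClosed.replaceAt {R : L.Term V → L.Term V → Prop} (hR : ContextClosed R)
    {p : List ℕ} {t s r : L.Term V} (h : subtermAt p t = some s) (hrs : R r s) :
    R (replaceAt p r t) t := by
  induction h using subtermAt_induction with
  | nil => exact hrs
  | cons f ts i p _ ih =>
    have := hR f ts i _ _ ih
    rwa [Function.update_eq_self, ← replaceAt_cons_func] at this

theorem contextClosed_isGround :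
    ContextClosed fun s t : L.Term V => IsGround t → IsGround s := by
  intro n f ts i s t hst ht
  rw [isGround_func, Function.forall_update_iff ts fun _ t => IsGround t] at ht ⊢
  exact ⟨hst ht.1, ht.2⟩

theorem contextClosed_realize_eq {M : Type*} [L.Structure M] (a : V → M) :
    ContextClosed fun s t : L.Term V => s.realize a = t.realize a := by
  intro n f ts i s t hst
  simp only [Term.realize_func]
  congr 1
  funext j
  rcases eq_or_ne j i with rfl | hj
  · simpa only [Function.update_self] using hst
  · simp only [Function.update_of_ne hj]

end Positions

end Terms

section Literals

variable {L : FirstOrder.Language.{u, 0}} {V : Type v}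

theorem mkLit_subst (b : Bool) (s t : L.Term V) (σ : Subst L V) :
    (mkLit b s t).subst σ = mkLit b (s.subst σ) (t.subst σ) := rfl

theorem Lit.eq_mkLit (K : Lit L V) : ∃ b s t, K = mkLit b s t :=
  K.atom.ind (f := fun e => ∃ b s t, (⟨K.pos, e⟩ : Lit L V) = mkLit b s t)
    fun s t => ⟨K.pos, s, t, rfl⟩

theorem Lit.comp_comp (K : Lit L V) : K.comp.comp = K :=
  congrArg (Lit.mk · K.atom) (Bool.not_not K.pos)

theorem Lit.comp_subst (K : Lit L V) (σ : Subst L V) : K.comp.subst σ = (K.subst σ).comp := rfl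

theorem Lit.subst_subst (K : Lit L V) (σ τ : Subst L V) :
    (K.subst σ).subst τ = K.subst (σ.comp τ) := by
  simp [Lit.subst, Sym2.map_map, SCLEQ.subst_subst]

theorem vars_mkLit {b : Bool} {s t : L.Term V} : (mkLit b s t).vars = vars s ∪ vars t := by
  ext x
  simp [Lit.vars, mkLit]

theorem Lit.subst_congr {K : Lit L V} {σ τ : Subst L V} (h : Set.EqOn σ τ K.vars) :
    K.subst σ = K.subst τ :=
  congrArg (Lit.mk K.pos) <|
    Sym2.map_congr fun t ht => subst_eq_subst_iff.2 fun _ hx => h ⟨t, ht, hx⟩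

theorem isGround_mkLit {b : Bool} {s t : L.Term V} :
    (mkLit b s t).IsGround ↔ IsGround s ∧ IsGround t := by
  simp [mkLit, Lit.IsGround]

theorem Lit.isGround_subst {K : Lit L V} {σ : Subst L V} :
    (K.subst σ).IsGround ↔ ∀ x ∈ K.vars, SCLEQ.IsGround (σ x) := by
  simp only [Lit.IsGround, Lit.subst, Sym2.mem_map, forall_exists_index, and_imp,
    forall_apply_eq_imp_iff₂, SCLEQ.isGround_subst, Lit.vars, Set.mem_ofPred_eq]
  exact ⟨fun h x t ht hx => h t ht x hx, fun h t ht x hx => h x t ht hx⟩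

theorem mem_clauseSubst {C : Clause L V} {σ : Subst L V} {H : Lit L V} :
    H ∈ clauseSubst C σ ↔ ∃ K ∈ C, K.subst σ = H := Multiset.mem_map

theorem clauseSubst_add (C D : Clause L V) (σ : Subst L V) :
    clauseSubst (C + D) σ = clauseSubst C σ + clauseSubst D σ := Multiset.map_add _ _ _

theorem forall_mem_clauseSubst_add {C D : Clause L V} {σ : Subst L V} {Q : Lit L V → Prop} :
    (∀ K ∈ clauseSubst (C + D) σ, Q K) ↔
      (∀ K ∈ clauseSubst C σ, Q K) ∧ ∀ K ∈ clauseSubst D σ, Q K := by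
  simp only [clauseSubst_add, Multiset.mem_add, or_imp, forall_and]

theorem clauseSubst_singleton (K : Lit L V) (σ : Subst L V) :
    clauseSubst {K} σ = {K.subst σ} := rfl

theorem clauseSubst_clauseSubst (C : Clause L V) (σ τ : Subst L V) :
    clauseSubst (clauseSubst C σ) τ = clauseSubst C (σ.comp τ) := by
  simp [clauseSubst, Multiset.map_map, Lit.subst_subst]

theorem clauseSubst_congr {C : Clause L V} {σ τ : Subst L V} (h : Set.EqOn σ τ (clauseVars C)) :
    clauseSubst C σ = clauseSubst C τ :=
  Multiset.map_congr rfl fun K hK => Lit.subst_congr fun _ hx => h ⟨K, hK, hx⟩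

theorem grounding_iff {C : Clause L V} {σ : Subst L V} :
    Grounding σ C ↔ ∀ x ∈ clauseVars C, IsGround (σ x) := by
  simp only [Grounding, clauseGround, clauseSubst, Multiset.forall_mem_map_iff, Lit.isGround_subst]
  exact ⟨fun h x ⟨K, hK, hx⟩ => h K hK x hx, fun h K hK x hx => h x ⟨K, hK, hx⟩⟩

theorem LitClosure.clauseSubst_clause (c : LitClosure L V) :
    clauseSubst c.clause c.subst = c.inst ::ₘ clauseSubst c.rest c.subst :=
  Multiset.map_cons _ _ _

section Ordering

theorem mulExt_singleton_right {α : Type*} {r : α → α → Prop} {M : Multiset α} {b : α} :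
    MulExt r M {b} ↔ ∀ y ∈ M, r y b := by
  constructor
  · rintro ⟨X, Y, Z, hZ, rfl, hb, hYZ⟩
    have hZb : Z = {b} :=
      (Multiset.le_singleton.1 (hb ▸ Multiset.le_add_left Z X)).resolve_left hZ
    have hX : X = 0 := left_eq_add.1 (hZb ▸ hb.trans (add_comm X Z))
    simpa [hX, hZb] using hYZ
  · exact fun h => ⟨0, M, {b}, Multiset.singleton_ne_zero b, (zero_add M).symm,
      (zero_add _).symm, fun y hy => ⟨b, Multiset.mem_singleton_self b, h y hy⟩⟩

theorem not_mulExt_singleton_left {α : Type*} {r : α → α → Prop} [Std.Asymm r]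
    {M : Multiset α} {b : α} (h : ∀ y ∈ M, r y b) : ¬ MulExt r {b} M := by
  rintro ⟨X, Y, Z, -, hb, rfl, hYZ⟩
  rcases Multiset.mem_add.1 (hb ▸ Multiset.mem_singleton_self b) with hX | hY
  · have hbb : r b b := h b (Multiset.mem_add.2 (.inl hX))
    exact Std.Asymm.asymm b b hbb hbb
  · obtain ⟨z, hz, hbz⟩ := hYZ b hY
    exact Std.Asymm.asymm b z hbz (h z (Multiset.mem_add.2 (.inr hz)))

variable {prec : L.Term V → L.Term V → Prop} {β : L.Term V}

theorem Lit.mem_toMS {K : Lit L V} {t : L.Term V} : t ∈ K.toMS ↔ t ∈ K.atom := by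
  unfold Lit.toMS
  split_ifs <;> simp

theorem litBelow_iff {K : Lit L V} : litBelow prec K β ↔ ∀ t ∈ K.atom, prec t β := by
  simp only [litBelow, mulExt_singleton_right, Lit.mem_toMS]

theorem litBelow_mkLit {b : Bool} {s t : L.Term V} :
    litBelow prec (mkLit b s t) β ↔ prec s β ∧ prec t β := by
  simp [litBelow_iff, mkLit]

theorem litBelow_comp {K : Lit L V} : litBelow prec K.comp β ↔ litBelow prec K β := by
  simp only [litBelow_iff, Lit.comp]

theorem clauseBelow_iff {C : Clause L V} :
    clauseBelow prec C β ↔ ∀ K ∈ C, litBelow prec K β := by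
  simp only [clauseBelow, mulExt_singleton_right, Multiset.forall_mem_map_iff, litBelow]

theorem LitBUndefined.litUndefined [Std.Asymm prec] {G : Set (Lit L V)} {K : Lit L V}
    (h : LitBUndefined prec β G K) (hK : litBelow prec K β) : LitUndefined G K :=
  h.resolve_left <| not_mulExt_singleton_left fun t ht => litBelow_iff.1 hK t (Lit.mem_toMS.1 ht)

end Ordering

end Literals

section Semantics

variable {L : FirstOrder.Language.{u, 0}} {V : Type v}

section Structures

variable {M : Type*} [L.Structure M]

theorem holds_mkLit {b : Bool} {s t : L.Term V} {a : V → M} :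
    (mkLit b s t).Holds a ↔ (b = true ↔ s.realize a = t.realize a) := by
  cases b <;> simp [Lit.Holds, mkLit]

theorem Lit.holds_comp {K : Lit L V} {a : V → M} : K.comp.Holds a ↔ ¬ K.Holds a := by
  obtain ⟨b, s, t, rfl⟩ := K.eq_mkLit
  cases b <;> simp [Lit.Holds, Lit.comp, mkLit]

theorem Lit.holds_subst {K : Lit L V} {σ : Subst L V} {a : V → M} :
    (K.subst σ).Holds a ↔ K.Holds fun x => (σ x).realize a := by
  obtain ⟨b, s, t, rfl⟩ := K.eq_mkLit
  simp only [mkLit_subst, holds_mkLit, Term.realize_subst]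

theorem Lit.holds_congr {K : Lit L V} {a b : V → M} (h : Set.EqOn a b K.vars) :
    K.Holds a ↔ K.Holds b := by
  unfold Lit.Holds
  rw [Sym2.map_congr fun t ht => realize_congr fun x hx => h ⟨t, ht, hx⟩]

theorem Lit.IsGround.holds_iff {K : Lit L V} (hK : K.IsGround) (a b : V → M) :
    K.Holds a ↔ K.Holds b :=
  Lit.holds_congr fun x ⟨t, ht, hx⟩ => absurd hx (hK t ht ▸ Set.notMem_empty x)

theorem modelsClause_singleton {K : Lit L V} :
    ModelsClause M ({K} : Clause L V) ↔ ∀ a : V → M, K.Holds a := by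
  simp [ModelsClause]

theorem ModelsClause.clauseSubst {C : Clause L V} (h : ModelsClause M C) (σ : Subst L V) :
    ModelsClause M (clauseSubst C σ) := fun a =>
  let ⟨K, hK, hKa⟩ := h fun x => (σ x).realize a
  ⟨K.subst σ, mem_clauseSubst.2 ⟨K, hK, rfl⟩, Lit.holds_subst.2 hKa⟩

/-- `M` is a model of all literals in `G`, read as unit clauses. -/
def ModelsLits (M : Type*) [L.Structure M] (G : Set (Lit L V)) : Prop :=
  ∀ K ∈ G, ∀ a : V → M, K.Holds a

end Structures

section Entailment

variable {N N' : Set (Clause L V)} {C D : Clause L V}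

theorem entails_of_mem (h : C ∈ N) : Entails N C := fun _ _ _ hM => hM C h

theorem Entails.trans (h : Entails N' C) (hN : ∀ D ∈ N', Entails N D) : Entails N C :=
  fun M _ _ hM => h M fun D hD => hN D hD M hM

theorem Entails.mono (h : Entails N C) (hN : N ⊆ N') : Entails N' C :=
  h.trans fun _ hD => entails_of_mem (hN hD)

theorem Entails.subset (h : Entails N C) (hCD : C ⊆ D) : Entails N D := fun M _ _ hM a =>
  let ⟨K, hK, hKa⟩ := h M hM a
  ⟨K, hCD hK, hKa⟩

theorem Entails.clauseSubst (h : Entails N C) (σ : Subst L V) : Entails N (clauseSubst C σ) :=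
  fun M _ _ hM => (h M hM).clauseSubst σ

theorem Entails.factor {μ : Subst L V} (h : Entails N (C + D))
    (hD : ∀ K ∈ D, ∃ H ∈ C, K.subst μ = H.subst μ) : Entails N (SCLEQ.clauseSubst C μ) := by
  refine (h.clauseSubst μ).subset fun H hH => ?_
  obtain ⟨K, hK, rfl⟩ := mem_clauseSubst.1 hH
  rcases Multiset.mem_add.1 hK with hC | hD'
  · exact mem_clauseSubst.2 ⟨K, hC, rfl⟩
  · obtain ⟨H, hH, hKH⟩ := hD K hD'
    exact mem_clauseSubst.2 ⟨H, hH, hKH.symm⟩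

theorem Entails.resolve_units (h : Entails N (C + D)) (hD : ∀ K ∈ D, Entails N {K.comp}) :
    Entails N C := by
  intro M _ _ hM a
  obtain ⟨K, hK, hKa⟩ := h M hM a
  refine ⟨K, (Multiset.mem_add.1 hK).resolve_right fun hKD => ?_, hKa⟩
  exact Lit.holds_comp.1 (modelsClause_singleton.1 (hD K hKD M hM) a) hKa

theorem entails_cons_comp (N : Set (Clause L V)) (K : Lit L V) : Entails N (K ::ₘ {K.comp}) := by
  intro M _ _ _ a
  by_cases h : K.Holds a
  · exact ⟨K, by simp, h⟩
  · exact ⟨K.comp, by simp, Lit.holds_comp.2 h⟩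

end Entailment

section GroundLiterals

variable {G G' : Set (Lit L V)} {K H : Lit L V}

theorem litEntails_iff : LitEntails G K ↔
    ∀ (M : Type u) [L.Structure M] [Nonempty M], ModelsLits M G → ∀ a : V → M, K.Holds a := by
  simp only [LitEntails, Entails, Set.forall_mem_image, modelsClause_singleton, ModelsLits]

theorem litEntails_of_mem (h : K ∈ G) : LitEntails G K :=
  entails_of_mem (Set.mem_image_of_mem _ h)

theorem LitEntails.mono (h : LitEntails G K) (hG : G ⊆ G') : LitEntails G' K :=
  Entails.mono h (Set.image_mono hG)

theorem LitEntails.entails {N : Set (Clause L V)} (h : LitEntails G K)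
    (hG : ∀ H ∈ G, Entails N {H}) : Entails N {K} :=
  Entails.trans h (Set.forall_mem_image.2 hG)

theorem Consistent.not_true_false (hG : Consistent G) (ht : LitTrue G K) (hf : LitFalse G K) :
    False := by
  obtain ⟨M, _, ⟨x⟩, hM⟩ := hG
  have hMG : ModelsLits M G := fun H hH => modelsClause_singleton.1 (hM H hH)
  have : Nonempty M := ⟨x⟩
  exact Lit.holds_comp.1 (litEntails_iff.1 hf M hMG fun _ => x) (litEntails_iff.1 ht M hMG _)

theorem consistent_empty : Consistent (∅ : Set (Lit L V)) :=
  ⟨PUnit, ⟨fun _ _ => PUnit.unit, fun _ _ => True⟩, inferInstance, fun _ h => h.elim⟩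

theorem consistent_insert (hK : K.IsGround) (h : ¬ LitFalse G K) : Consistent (insert K G) := by
  simp only [LitFalse, litEntails_iff, not_forall, Lit.holds_comp, not_not] at h
  obtain ⟨M, _, _, hM, a, ha⟩ := h
  refine ⟨M, inferInstance, inferInstance, ?_⟩
  simp only [modelsClause_singleton, Set.forall_mem_insert]
  exact ⟨fun a' => (hK.holds_iff a a').1 ha, hM⟩

theorem litEntails_congr
    (h : ∀ (M : Type u) [L.Structure M] [Nonempty M], ModelsLits M G →
      ∀ a : V → M, K.Holds a ↔ H.Holds a) :
    LitEntails G K ↔ LitEntails G H := by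
  simp only [litEntails_iff]
  exact forall₄_congr fun M _ _ hM => forall_congr' (h M hM)

theorem litUndefined_congr
    (h : ∀ (M : Type u) [L.Structure M] [Nonempty M], ModelsLits M G →
      ∀ a : V → M, K.Holds a ↔ H.Holds a) :
    LitUndefined G K ↔ LitUndefined G H :=
  not_congr <| or_congr (litEntails_congr h) <| litEntails_congr fun M _ _ hM a => by
    rw [Lit.holds_comp, Lit.holds_comp, h M hM a]

end GroundLiterals

end Semantics

section Rewriting

variable {L : FirstOrder.Language.{u, 0}} {V : Type v} {prec : L.Term V → L.Term V → Prop}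
  {G : Set (Lit L V)} {K H : Lit L V}

section Models

variable {M : Type u} [L.Structure M] [Nonempty M]

theorem ModelsLits.realize_eq_of_rewrites (hM : ModelsLits M G) {s t : L.Term V}
    (h : Rewrites (conv prec G) s t) (a : V → M) : s.realize a = t.realize a := by
  obtain ⟨⟨l, r⟩, ⟨-, -, -, hlr⟩, p, σ, hp, rfl⟩ := h
  refine ((contextClosed_realize_eq a).replaceAt hp ?_).symm
  have hrule := litEntails_iff.1 (hlr.mono (Set.sep_subset _ _)) M hM fun x => (σ x).realize a
  simpa only [Term.realize_subst] using ((holds_mkLit.1 hrule).1 rfl).symm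

theorem ModelsLits.realize_eq_of_isNormalForm (hM : ModelsLits M G) {s t : L.Term V}
    (h : IsNormalForm (conv prec G) s t) (a : V → M) : s.realize a = t.realize a := by
  replace h := h.1
  induction h with
  | refl => rfl
  | tail _ hstep ih => exact ih.trans (hM.realize_eq_of_rewrites hstep a)

theorem LitNormalForm.holds_iff (h : LitNormalForm (conv prec G) K H) (hM : ModelsLits M G)
    (a : V → M) : K.Holds a ↔ H.Holds a := by
  obtain ⟨s, t, s', t', hK, rfl, hs, ht⟩ := h
  rw [hK, holds_mkLit, holds_mkLit, hM.realize_eq_of_isNormalForm hs,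
    hM.realize_eq_of_isNormalForm ht]
  rfl

end Models

theorem LitNormalForm.litUndefined_iff (h : LitNormalForm (conv prec G) K H) :
    LitUndefined G K ↔ LitUndefined G H :=
  litUndefined_congr fun _ _ _ hM a => h.holds_iff hM a

theorem LitNormalForm.irreducible {R : TRS L V} (h : LitNormalForm R K H) : H.Irreducible R := by
  obtain ⟨s, t, s', t', -, rfl, hs, ht⟩ := h
  exact Sym2.ball.2 ⟨hs.2, ht.2⟩

/-- `H` arises from `K` by replacing one occurrence of `l` by `r`. Literals are unordered, so the
side of `K` containing the occurrence is written first. -/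
inductive LitRewrites (l r : L.Term V) : Lit L V → Lit L V → Prop
  | intro {p : List ℕ} {t : L.Term V} (b : Bool) (u : L.Term V) (h : subtermAt p t = some l) :
      LitRewrites l r (mkLit b t u) (mkLit b (replaceAt p r t) u)

variable {l r : L.Term V}

theorem LitRewrites.subst (h : LitRewrites l r K H) (σ : Subst L V) :
    LitRewrites (l.subst σ) (r.subst σ) (K.subst σ) (H.subst σ) := by
  obtain ⟨b, u, hp⟩ := h
  rw [mkLit_subst, mkLit_subst, replaceAt_subst hp]
  exact .intro b (u.subst σ) (subtermAt_subst hp σ)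

theorem LitRewrites.isGround (h : LitRewrites l r K H) (hr : IsGround r) (hK : K.IsGround) :
    H.IsGround := by
  obtain ⟨b, u, hp⟩ := h
  rw [isGround_mkLit] at hK ⊢
  exact ⟨contextClosed_isGround.replaceAt hp (fun _ => hr) hK.1, hK.2⟩

theorem LitRewrites.litBelow [IsTrans (L.Term V) prec] (hctx : ContextClosed prec) {β : L.Term V}
    (h : LitRewrites l r K H) (hrl : prec r l) (hK : litBelow prec K β) : litBelow prec H β := by
  obtain ⟨b, u, hp⟩ := h
  rw [litBelow_mkLit] at hK ⊢
  exact ⟨_root_.trans (hctx.replaceAt hp hrl) hK.1, hK.2⟩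

theorem LitRewrites.holds_iff {M : Type*} [L.Structure M] {a : V → M} (h : LitRewrites l r K H)
    (hrl : r.realize a = l.realize a) : H.Holds a ↔ K.Holds a := by
  obtain ⟨b, u, hp⟩ := h
  rw [holds_mkLit, holds_mkLit, (contextClosed_realize_eq a).replaceAt hp hrl]

end Rewriting

section Inferences

variable {L : FirstOrder.Language.{u, 0}} {V : Type v} {prec : L.Term V → L.Term V → Prop}
  {c d c₁ c₂ d₁ d₂ e out : LitClosure L V} {p : List ℕ}

/-- `d` is a specialization of `c`: its clause is an instance of the clause of `c`, but the ground
clause it stands for is the same. Renamings and the unifier of a rewrite inference specialize the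
premises of the inference. -/
structure Specializes (d c : LitClosure L V) : Prop where
  clause : ∃ θ, d.clause = clauseSubst c.clause θ
  inst : d.inst = c.inst
  rest : clauseSubst d.rest d.subst = clauseSubst c.rest c.subst

theorem LitClosure.lit_vars_subset (c : LitClosure L V) : c.lit.vars ⊆ c.vars :=
  fun _ hx => ⟨c.lit, Multiset.mem_cons_self _ _, hx⟩

theorem LitClosure.rest_vars_subset (c : LitClosure L V) : clauseVars c.rest ⊆ c.vars :=
  fun _ ⟨K, hK, hx⟩ => ⟨K, Multiset.mem_cons_of_mem hK, hx⟩

theorem specializes_of_eqOn {θ τ : Subst L V} (h : Set.EqOn (θ.comp τ) c.subst c.vars) :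
    Specializes ⟨c.lit.subst θ, clauseSubst c.rest θ, τ⟩ c where
  clause := ⟨θ, (Multiset.map_cons _ _ _).symm⟩
  inst := (c.lit.subst_subst θ τ).trans <| Lit.subst_congr <|
    h.mono c.lit_vars_subset
  rest := (clauseSubst_clauseSubst _ _ _).trans <| clauseSubst_congr <|
    h.mono c.rest_vars_subset

theorem specializes_rename (c : LitClosure L V) (ρ : Equiv.Perm V) : Specializes (c.rename ρ) c :=
  specializes_of_eqOn fun x _ => congrArg c.subst (ρ.symm_apply_apply x)

theorem Specializes.trans (h : Specializes e d) (h' : Specializes d c) : Specializes e c where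
  clause := by
    obtain ⟨θ, hθ⟩ := h.clause
    obtain ⟨θ', hθ'⟩ := h'.clause
    exact ⟨θ'.comp θ, by rw [hθ, hθ', clauseSubst_clauseSubst]⟩
  inst := h.inst.trans h'.inst
  rest := h.rest.trans h'.rest

theorem Specializes.clauseSubst_clause (h : Specializes d c) :
    clauseSubst d.clause d.subst = clauseSubst c.clause c.subst := by
  rw [d.clauseSubst_clause, c.clauseSubst_clause, h.inst, h.rest]

theorem Specializes.grounding (h : Specializes d c) (hc : Grounding c.subst c.clause) :
    Grounding d.subst d.clause := by
  rwa [Grounding, h.clauseSubst_clause]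

/-- `out` results from rewriting with `d₁` inside `d₂` where no unification is needed: all three
closures share one substitution, and the left-hand side of `d₁` occurs literally in `d₂`. Every
rewrite inference has this form after specializing its premises. -/
structure IsParamodulant (prec : L.Term V → L.Term V → Prop) (d₁ d₂ out : LitClosure L V) :
    Prop where
  left_subst : d₁.subst = out.subst
  right_subst : d₂.subst = out.subst
  lit : ∃ l r, d₁.lit = mkLit true l r ∧ prec (r.subst out.subst) (l.subst out.subst) ∧
    LitRewrites l r d₂.lit out.lit
  rest : out.rest = d₁.rest + d₂.rest

theorem eqOn_comp_comp_of_fresh {δ ρ σ₁ σ₂ : Subst L V} {X₁ X₂ : Set V} (hX : Disjoint X₁ X₂)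
    (hσ₂ : ∀ x ∈ X₂, IsGround (σ₂ x)) (hfresh : ∀ x ∈ δ.dom, Disjoint (vars (δ x)) X₁)
    (hδ : Set.EqOn (δ.comp ((σ₂.restrict X₂).comp ρ)) (σ₂.restrict X₂) δ.dom) :
    Set.EqOn (δ.comp (((σ₁.restrict X₁).comp (σ₂.restrict X₂)).comp ρ)) σ₂ X₂ := by
  intro x hx
  have hdisj : Disjoint (vars (δ x)) X₁ := by
    by_cases hxδ : x ∈ δ.dom
    · exact hfresh x hxδ
    · rw [not_not.1 hxδ]
      exact Set.disjoint_singleton_left.2 (Set.disjoint_right.1 hX hx)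
  rw [Subst.comp, Subst.comp_assoc, subst_restrict_comp_of_disjoint hdisj]
  exact Subst.comp_restrict_comp_eqOn hσ₂ hδ hx

theorem eqOn_comp_comp_of_subst_eq {δ σ ρ : Subst L V} {t : L.Term V}
    (h : ((t.subst δ).subst σ).subst ρ = t.subst σ) :
    Set.EqOn (δ.comp (σ.comp ρ)) σ (vars t) := by
  rwa [subst_subst, subst_subst, subst_eq_subst_iff] at h

theorem DisjointRewriteInference.exists_isParamodulant
    (h : DisjointRewriteInference prec c₁ c₂ p out) (h₁ : Grounding c₁.subst c₁.clause)
    (h₂ : Grounding c₂.subst c₂.clause) :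
    ∃ d₁ d₂, Specializes d₁ c₁ ∧ Specializes d₂ c₂ ∧ IsParamodulant prec d₁ d₂ out := by
  obtain ⟨b, l₁, r₁, l₂, r₂, s, δ, ρ, μ, hc₁, hc₂, hdisj, hlt, hp, hδ, hs, hμ, hlit, hrest,
    hsubst⟩ := h
  rw [grounding_iff] at h₁ h₂
  have hτ₁ : Set.EqOn out.subst c₁.subst c₁.vars := by
    rw [hsubst, Subst.comp_assoc]
    exact Subst.restrict_comp_eqOn h₁ _
  have hτ₂ : Set.EqOn (δ.comp out.subst) c₂.subst c₂.vars := by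
    rw [hsubst]
    rcases hδ with ⟨-, rfl, rfl⟩ | ⟨-, hdom, hfresh, ⟨-, hl, hr⟩, -, -⟩
    · refine eqOn_comp_comp_of_fresh hdisj h₂ ?_ ?_ <;> exact fun x hx => absurd rfl hx
    · exact eqOn_comp_comp_of_fresh hdisj h₂
        (fun x hx => (Set.disjoint_union_right.1 (hfresh x hx)).1)
        (((eqOn_comp_comp_of_subst_eq hl).union (eqOn_comp_comp_of_subst_eq hr)).mono hdom)
  have hv₁ := vars_mkLit ▸ hc₁ ▸ c₁.lit_vars_subset
  have hv₂ := vars_mkLit ▸ hc₂ ▸ c₂.lit_vars_subset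
  have hl₁ := subst_eq_subst_iff.2 (hτ₁.mono (Set.subset_union_left.trans hv₁))
  have hr₁ := subst_eq_subst_iff.2 (hτ₁.mono (Set.subset_union_right.trans hv₁))
  have hl₂ := subst_eq_subst_iff.2 (hτ₂.mono (Set.subset_union_left.trans hv₂))
  have hμτ : μ.comp out.subst = out.subst := hμ.comp_eq <| by
    rintro _ rfl
    have hs' := subtermAt_subst hs out.subst
    rw [subst_subst, hl₂, hp, ← hl₁] at hs'
    exact (Option.some.inj hs').symm
  have hunif : s.subst μ = l₁.subst μ := hμ.unifies _ rfl
  refine ⟨_, _, specializes_of_eqOn (θ := μ) (hμτ.symm ▸ hτ₁),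
    specializes_of_eqOn (θ := δ.comp μ) (by rwa [Subst.comp_assoc, hμτ]), rfl, rfl, ?_, ?_⟩
  · refine ⟨l₁.subst μ, r₁.subst μ, by rw [hc₁, mkLit_subst], ?_, ?_⟩
    · rwa [subst_subst, subst_subst, hμτ, hl₁, hr₁]
    · rw [hc₂, hlit, mkLit_subst, ← subst_subst, ← subst_subst, replaceAt_subst hs]
      exact .intro b _ (hunif ▸ subtermAt_subst hs μ)
  · rw [hrest, clauseSubst_clauseSubst]

theorem RewriteInference.exists_isParamodulant (h : RewriteInference prec c₁ c₂ p out)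
    (h₁ : Grounding c₁.subst c₁.clause) (h₂ : Grounding c₂.subst c₂.clause) :
    ∃ d₁ d₂, Specializes d₁ c₁ ∧ Specializes d₂ c₂ ∧ IsParamodulant prec d₁ d₂ out := by
  obtain ⟨ρ₁, ρ₂, h⟩ := h
  have hρ₁ := specializes_rename c₁ ρ₁
  have hρ₂ := specializes_rename c₂ ρ₂
  obtain ⟨d₁, d₂, hd₁, hd₂, hout⟩ :=
    h.exists_isParamodulant (hρ₁.grounding h₁) (hρ₂.grounding h₂)
  exact ⟨d₁, d₂, hd₁.trans hρ₁, hd₂.trans hρ₂, hout⟩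

end Inferences

section SoundClosures

variable {L : FirstOrder.Language.{u, 0}} {V : Type v} {prec : L.Term V → L.Term V → Prop}
  {β : L.Term V} {N N' : Set (Clause L V)} {G : Set (Lit L V)}
  {c d c₁ c₂ d₁ d₂ out : LitClosure L V} {p : List ℕ}

theorem forall_mem_clauseSubst_clause {Q : Lit L V → Prop} :
    (∀ K ∈ clauseSubst c.clause c.subst, Q K) ↔
      Q c.inst ∧ ∀ K ∈ clauseSubst c.rest c.subst, Q K := by
  rw [c.clauseSubst_clause, Multiset.forall_mem_cons]

theorem IsParamodulant.forall_mem_clauseSubst_rest {Q : Lit L V → Prop}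
    (h : IsParamodulant prec d₁ d₂ out) (h₁ : ∀ K ∈ clauseSubst d₁.rest d₁.subst, Q K)
    (h₂ : ∀ K ∈ clauseSubst d₂.rest d₂.subst, Q K) :
    ∀ K ∈ clauseSubst out.rest out.subst, Q K := by
  rw [h.left_subst] at h₁
  rw [h.right_subst] at h₂
  rw [h.rest]
  exact forall_mem_clauseSubst_add.2 ⟨h₁, h₂⟩

theorem IsParamodulant.inst (h : IsParamodulant prec d₁ d₂ out) :
    ∃ l r, d₁.inst = mkLit true l r ∧ prec r l ∧ LitRewrites l r d₂.inst out.inst := by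
  obtain ⟨l, r, hlit, hrl, hrew⟩ := h.lit
  refine ⟨l.subst out.subst, r.subst out.subst, ?_, hrl, ?_⟩
  · rw [LitClosure.inst, hlit, mkLit_subst, h.left_subst]
  · rw [LitClosure.inst, h.right_subst]
    exact hrew.subst out.subst

theorem IsParamodulant.grounding (h : IsParamodulant prec d₁ d₂ out)
    (h₁ : Grounding d₁.subst d₁.clause) (h₂ : Grounding d₂.subst d₂.clause) :
    Grounding out.subst out.clause := by
  rw [Grounding, clauseGround, forall_mem_clauseSubst_clause] at h₁ h₂ ⊢
  obtain ⟨l, r, hlit, -, hrew⟩ := h.inst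
  rw [hlit, isGround_mkLit] at h₁
  exact ⟨hrew.isGround h₁.1.2 h₂.1, h.forall_mem_clauseSubst_rest h₁.2 h₂.2⟩

theorem IsParamodulant.clauseBelow [IsTrans (L.Term V) prec] (hctx : ContextClosed prec)
    (h : IsParamodulant prec d₁ d₂ out)
    (h₁ : clauseBelow prec (clauseSubst d₁.clause d₁.subst) β)
    (h₂ : clauseBelow prec (clauseSubst d₂.clause d₂.subst) β) :
    clauseBelow prec (clauseSubst out.clause out.subst) β := by
  rw [clauseBelow_iff, forall_mem_clauseSubst_clause] at h₁ h₂ ⊢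
  obtain ⟨l, r, -, hrl, hrew⟩ := h.inst
  exact ⟨hrew.litBelow hctx hrl h₂.1, h.forall_mem_clauseSubst_rest h₁.2 h₂.2⟩

theorem IsParamodulant.entails (h : IsParamodulant prec d₁ d₂ out) (h₁ : Entails N d₁.clause)
    (h₂ : Entails N d₂.clause) : Entails N out.clause := by
  intro M _ _ hM a
  obtain ⟨l, r, hlit, -, hrew⟩ := h.lit
  have of_rest : ∀ K ∈ d₁.rest + d₂.rest, K.Holds a → ∃ K ∈ out.clause, K.Holds a :=
    fun K hK hKa => ⟨K, Multiset.mem_cons_of_mem (h.rest ▸ hK), hKa⟩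
  obtain ⟨K₁, hK₁, hK₁a⟩ := h₁ M hM a
  obtain ⟨K₂, hK₂, hK₂a⟩ := h₂ M hM a
  rcases Multiset.mem_cons.1 hK₁ with rfl | hK₁
  · rcases Multiset.mem_cons.1 hK₂ with rfl | hK₂
    · rw [hlit, holds_mkLit] at hK₁a
      exact ⟨out.lit, Multiset.mem_cons_self _ _, (hrew.holds_iff (hK₁a.1 rfl).symm).2 hK₂a⟩
    · exact of_rest K₂ (Multiset.mem_add.2 (.inr hK₂)) hK₂a
  · exact of_rest K₁ (Multiset.mem_add.2 (.inl hK₁)) hK₁a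

/-- The invariant of the closures handled by the calculus: the clause is entailed by `N`, and its
ground instance lies below `β`. -/
structure SoundClosure (prec : L.Term V → L.Term V → Prop) (β : L.Term V) (N : Set (Clause L V))
    (c : LitClosure L V) : Prop where
  grounding : Grounding c.subst c.clause
  entails : Entails N c.clause
  below : clauseBelow prec (clauseSubst c.clause c.subst) β

theorem SoundClosure.mono (h : SoundClosure prec β N c) (hN : N ⊆ N') :
    SoundClosure prec β N' c :=
  { h with entails := h.entails.mono hN }

theorem SoundClosure.inst_isGround (h : SoundClosure prec β N c) : c.inst.IsGround :=
  (forall_mem_clauseSubst_clause.1 h.grounding).1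

theorem SoundClosure.inst_below (h : SoundClosure prec β N c) : litBelow prec c.inst β :=
  (forall_mem_clauseSubst_clause.1 (clauseBelow_iff.1 h.below)).1

theorem SoundClosure.rest_below (h : SoundClosure prec β N c) :
    clauseBelow prec (clauseSubst c.rest c.subst) β :=
  clauseBelow_iff.2 (forall_mem_clauseSubst_clause.1 (clauseBelow_iff.1 h.below)).2

theorem SoundClosure.of_specializes (h : SoundClosure prec β N c) (hd : Specializes d c) :
    SoundClosure prec β N d where
  grounding := hd.grounding h.grounding
  entails := hd.clause.elim fun θ hθ => hθ ▸ h.entails.clauseSubst θ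
  below := hd.clauseSubst_clause ▸ h.below

theorem SoundClosure.rewriteInference [IsTrans (L.Term V) prec] (hctx : ContextClosed prec)
    (h₁ : SoundClosure prec β N c₁) (h₂ : SoundClosure prec β N c₂)
    (h : RewriteInference prec c₁ c₂ p out) : SoundClosure prec β N out := by
  obtain ⟨d₁, d₂, hd₁, hd₂, hout⟩ := h.exists_isParamodulant h₁.grounding h₂.grounding
  replace h₁ := h₁.of_specializes hd₁
  replace h₂ := h₂.of_specializes hd₂
  exact ⟨hout.grounding h₁.grounding h₂.grounding, hout.entails h₁.entails h₂.entails,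
    hout.clauseBelow hctx h₁.below h₂.below⟩

theorem RewriteInference.rest_false (h : RewriteInference prec c₁ c₂ p out)
    (h₁ : Grounding c₁.subst c₁.clause) (h₂ : Grounding c₂.subst c₂.clause)
    (hf₁ : ClauseFalse G (clauseSubst c₁.rest c₁.subst))
    (hf₂ : ClauseFalse G (clauseSubst c₂.rest c₂.subst)) :
    ClauseFalse G (clauseSubst out.rest out.subst) := by
  obtain ⟨d₁, d₂, hd₁, hd₂, hout⟩ := h.exists_isParamodulant h₁ h₂
  exact hout.forall_mem_clauseSubst_rest (hd₁.rest ▸ hf₁) (hd₂.rest ▸ hf₂)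

theorem SoundClosure.tautology (h : SoundClosure prec β N c) :
    SoundClosure prec β N ⟨c.lit, {c.lit.comp}, c.subst⟩ where
  grounding := forall_mem_clauseSubst_clause.2 ⟨h.inst_isGround, fun K hK => by
    rw [clauseSubst_singleton, Multiset.mem_singleton] at hK
    exact hK ▸ h.inst_isGround⟩
  entails := entails_cons_comp N c.lit
  below := clauseBelow_iff.2 <| forall_mem_clauseSubst_clause.2 ⟨h.inst_below, fun K hK => by
    rw [clauseSubst_singleton, Multiset.mem_singleton, Lit.comp_subst] at hK
    exact hK ▸ litBelow_comp.2 h.inst_below⟩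

theorem ReductionChain.induction {avail : Set (LitClosure L V)} {P : List (RewriteStep L V)}
    (hP : ReductionChain prec avail P) {Q : LitClosure L V → Prop} (havail : ∀ c ∈ avail, Q c)
    (hinf : ∀ c₁ c₂ p out, Q c₁ → Q c₂ → RewriteInference prec c₁ c₂ p out → Q out) :
    ∀ I ∈ P, Q I.closure := by
  induction P using List.reverseRecOn with
  | nil => exact fun I hI => absurd hI List.not_mem_nil
  | append_singleton P J ih =>
    have hP' : ReductionChain prec avail P := fun P₁ I P₂ h => hP P₁ I (P₂ ++ [J]) (by simp [h])
    refine List.forall_mem_append.2 ⟨ih hP', List.forall_mem_singleton.2 ?_⟩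
    have hJ : J.Justified prec avail P := hP P J [] rfl
    cases J with
    | leaf c => exact havail c hJ
    | infer c R S p =>
      obtain ⟨hR, hS, hc⟩ := hJ
      exact hinf _ _ p c (ih hP' R hR) (ih hP' S hS) hc

end SoundClosures

section Trails

variable {L : FirstOrder.Language.{u, 0}} {V : Type v} {prec : L.Term V → L.Term V → Prop}
  {β : L.Term V} {N N' : Set (Clause L V)} {Γ Γ' : Trail L V} {e : AnnLit L V} {K : Lit L V}

theorem lits_concat (Γ : Trail L V) (e : AnnLit L V) :
    lits (Γ ++ [e]) = insert e.inst (lits Γ) := by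
  ext K
  simp [lits, or_and_right, exists_or, or_comm, eq_comm]

theorem lits_subset_append (Γ Γ' : Trail L V) : lits Γ ⊆ lits (Γ ++ Γ') :=
  fun _ ⟨e, he, hK⟩ => ⟨e, List.mem_append_left _ he, hK⟩

theorem lastLevel_concat (Γ : Trail L V) (e : AnnLit L V) : lastLevel (Γ ++ [e]) = e.level := by
  simp [lastLevel]

/-- The invariant of a trail entry `e` following the trail prefix `Γ`. It also records that the
level of a propagated literal is exactly the level before it: `IsDecision` only excludes that it is
one more. -/
structure SoundEntry (prec : L.Term V → L.Term V → Prop) (β : L.Term V) (N : Set (Clause L V))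
    (Γ : Trail L V) (e : AnnLit L V) : Prop where
  closure : SoundClosure prec β N e.closure
  undefined : LitUndefined (lits Γ) e.inst
  irreducible : e.inst.Irreducible (conv prec (lits Γ))
  level : IsDecision Γ e ∧ e.closure.rest = {e.closure.lit.comp} ∨
    e.level = lastLevel Γ ∧ ClauseFalse (lits Γ) (clauseSubst e.closure.rest e.closure.subst)

theorem SoundEntry.of_isDecision (h : SoundEntry prec β N Γ e) (hd : IsDecision Γ e) :
    e.closure.rest = {e.closure.lit.comp} :=
  (h.level.resolve_right fun h => by rw [IsDecision, h.1] at hd; omega).2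

theorem SoundEntry.of_not_isDecision (h : SoundEntry prec β N Γ e) (hd : ¬ IsDecision Γ e) :
    e.level = lastLevel Γ ∧ ClauseFalse (lits Γ) (clauseSubst e.closure.rest e.closure.subst) :=
  h.level.resolve_left fun h => hd h.1

theorem SoundEntry.lastLevel_le (h : SoundEntry prec β N Γ e) : lastLevel Γ ≤ e.level := by
  by_cases hd : IsDecision Γ e
  · exact (Nat.le_succ _).trans_eq hd.symm
  · exact (h.of_not_isDecision hd).1.ge

/-- The invariant of the trail of a state: each entry is sound with respect to the prefix
preceding it. -/
def SoundTrail (prec : L.Term V → L.Term V → Prop) (β : L.Term V) (N : Set (Clause L V))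
    (Γ : Trail L V) : Prop :=
  ∀ Γ₁ e Γ₂, Γ = Γ₁ ++ e :: Γ₂ → SoundEntry prec β N Γ₁ e

theorem soundTrail_nil : SoundTrail prec β N [] := fun _ _ _ h => by simp at h

theorem SoundTrail.mono (h : SoundTrail prec β N Γ) (hN : N ⊆ N') : SoundTrail prec β N' Γ :=
  fun Γ₁ e Γ₂ hΓ => { h Γ₁ e Γ₂ hΓ with closure := (h Γ₁ e Γ₂ hΓ).closure.mono hN }

theorem SoundTrail.of_append (h : SoundTrail prec β N (Γ ++ Γ')) : SoundTrail prec β N Γ :=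
  fun Γ₁ e Γ₂ hΓ => h Γ₁ e (Γ₂ ++ Γ') (by simp [hΓ])

theorem soundTrail_concat_iff :
    SoundTrail prec β N (Γ ++ [e]) ↔ SoundTrail prec β N Γ ∧ SoundEntry prec β N Γ e := by
  refine ⟨fun h => ⟨h.of_append, h Γ e [] rfl⟩, fun ⟨h, he⟩ Γ₁ e' Γ₂ hΓ => ?_⟩
  rcases List.eq_nil_or_concat Γ₂ with rfl | ⟨Γ₃, x, rfl⟩
  · obtain ⟨rfl, heq⟩ := List.append_inj' hΓ rfl
    rwa [← List.singleton_inj.1 heq]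
  · rw [List.concat_eq_append, ← List.cons_append, ← List.append_assoc] at hΓ
    exact h Γ₁ e' Γ₃ (List.append_inj' hΓ rfl).1

theorem SoundTrail.exists_prefix (h : SoundTrail prec β N Γ) (he : e ∈ Γ) :
    ∃ Γ₁, lits Γ₁ ⊆ lits Γ ∧ SoundEntry prec β N Γ₁ e := by
  obtain ⟨Γ₁, Γ₂, rfl⟩ := List.append_of_mem he
  exact ⟨Γ₁, lits_subset_append _ _, h _ _ _ rfl⟩

theorem SoundTrail.soundClosure (h : SoundTrail prec β N Γ) (he : e ∈ Γ) :
    SoundClosure prec β N e.closure :=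
  let ⟨_, _, he'⟩ := h.exists_prefix he
  he'.closure

theorem SoundTrail.consistent (h : SoundTrail prec β N Γ) : Consistent (lits Γ) := by
  rcases List.eq_nil_or_concat Γ with rfl | ⟨Γ', e, rfl⟩
  · simpa [lits] using consistent_empty
  · rw [List.concat_eq_append] at h ⊢
    have he := (soundTrail_concat_iff.1 h).2
    rw [lits_concat]
    exact consistent_insert he.closure.inst_isGround fun hf => he.undefined (.inr hf)

theorem SoundTrail.rest_false (h : SoundTrail prec β N Γ) (he : e ∈ Γ) :
    ClauseFalse (lits Γ) (clauseSubst e.closure.rest e.closure.subst) := by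
  obtain ⟨Γ₁, hΓ₁, hs⟩ := h.exists_prefix he
  by_cases hd : IsDecision Γ₁ e
  · rw [hs.of_isDecision hd, clauseSubst_singleton]
    intro K hK
    rw [Multiset.mem_singleton.1 hK, LitFalse, Lit.comp_subst, Lit.comp_comp]
    exact litEntails_of_mem ⟨e, he, rfl⟩
  · exact fun K hK => ((hs.of_not_isDecision hd).2 K hK).mono hΓ₁

section Levels

theorem SoundTrail.level_le_lastLevel (h : SoundTrail prec β N Γ) :
    ∀ e ∈ Γ, e.level ≤ lastLevel Γ := by
  induction Γ using List.reverseRecOn with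
  | nil => exact fun e he => absurd he List.not_mem_nil
  | append_singleton Γ e ih =>
    obtain ⟨hΓ, he⟩ := soundTrail_concat_iff.1 h
    rw [lastLevel_concat]
    exact List.forall_mem_append.2 ⟨fun e' he' => (ih hΓ e' he').trans he.lastLevel_le,
      List.forall_mem_singleton.2 le_rfl⟩

theorem SoundTrail.pairwise_level (h : SoundTrail prec β N Γ) :
    Γ.Pairwise fun e e' => e.level ≤ e'.level := by
  induction Γ using List.reverseRecOn with
  | nil => exact .nil
  | append_singleton Γ e ih =>
    obtain ⟨hΓ, he⟩ := soundTrail_concat_iff.1 h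
    refine List.pairwise_append.2 ⟨ih hΓ, List.pairwise_singleton _ _, fun e' he' => ?_⟩
    exact List.forall_mem_singleton.2 ((hΓ.level_le_lastLevel e' he').trans he.lastLevel_le)

theorem SoundTrail.level_mono (h : SoundTrail prec β N Γ) :
    Monotone fun i : Fin Γ.length => (Γ.get i).level :=
  monotone_iff_forall_lt.2 (List.pairwise_iff_get.1 h.pairwise_level)

theorem SoundTrail.entails_of_level_eq_zero (h : SoundTrail prec β N Γ) :
    ∀ e ∈ Γ, e.level = 0 → Entails N {e.inst} := by
  induction Γ using List.reverseRecOn with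
  | nil => exact fun e he => absurd he List.not_mem_nil
  | append_singleton Γ e ih =>
    obtain ⟨hΓ, he⟩ := soundTrail_concat_iff.1 h
    refine List.forall_mem_append.2 ⟨ih hΓ, List.forall_mem_singleton.2 fun h0 => ?_⟩
    have hlast : lastLevel Γ = 0 := Nat.le_zero.1 (h0 ▸ he.lastLevel_le)
    have hlits : ∀ H ∈ lits Γ, Entails N {H} := by
      rintro _ ⟨e', he', rfl⟩
      exact ih hΓ e' he' (Nat.le_zero.1 (hlast ▸ hΓ.level_le_lastLevel e' he'))
    have hd : ¬ IsDecision Γ e := fun hd => Nat.succ_ne_zero _ (hd.symm.trans h0)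
    refine Entails.resolve_units (D := clauseSubst e.closure.rest e.closure.subst) ?_
      fun K hK => ((he.of_not_isDecision hd).2 K hK).entails hlits
    rw [AnnLit.inst, Multiset.singleton_add, ← e.closure.clauseSubst_clause]
    exact he.closure.entails.clauseSubst _

theorem subLits_empty (Γ : Trail L V) : subLits Γ ∅ = ∅ := by
  simp [subLits]

theorem subLits_univ (Γ : Trail L V) : subLits Γ Set.univ = lits Γ := by
  ext K
  simp [subLits, lits, List.mem_iff_get]

theorem subLits_subset_lits (Γ : Trail L V) (S : Set (Fin Γ.length)) : subLits Γ S ⊆ lits Γ :=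
  fun _ ⟨i, _, hi⟩ => ⟨Γ.get i, List.get_mem _ _, hi⟩

theorem isCore_iff_minimal {S : Set (Fin Γ.length)} :
    IsCore Γ K S ↔ Minimal (fun S => LitDefined (subLits Γ S) K) S :=
  ⟨fun h => minimal_iff_forall_lt.2 ⟨h.1, fun S' => h.2 S'⟩,
    fun h => ⟨h.1, fun _ hS' => (minimal_iff_forall_lt.1 h).2 hS'⟩⟩

theorem IsCore.exists_isGreatest {S : Set (Fin Γ.length)} (hS : IsCore Γ K S)
    (h0 : ¬ LitDefined ∅ K) : ∃ i, IsGreatest S i := by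
  have hne : S.Nonempty := Set.nonempty_iff_ne_empty.2 fun h => h0 <| by
    simpa only [h, subLits_empty] using hS.1
  obtain ⟨i, hi, hmax⟩ := Set.exists_max_image S id S.toFinite hne
  exact ⟨i, hi, hmax⟩

theorem exists_isDefining (hK : LitDefined (lits Γ) K) (h0 : ¬ LitDefined ∅ K) :
    ∃ i, IsDefining Γ K i := by
  have hcore : ∃ S, IsCore Γ K S := by
    simp only [isCore_iff_minimal]
    exact exists_minimal_of_wellFoundedLT _ ⟨Set.univ, by rwa [subLits_univ]⟩
  obtain ⟨S, hS⟩ := hcore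
  obtain ⟨i, hi⟩ := hS.exists_isGreatest h0
  obtain ⟨j, ⟨T, hT, hTj⟩, hmin⟩ := exists_minimal_of_wellFoundedLT
    (fun j => ∃ T, IsCore Γ K T ∧ IsGreatest T j) ⟨i, S, hS, hi⟩
  refine ⟨j, T, hT, hTj, fun S' hS' => ?_⟩
  obtain ⟨k, hk⟩ := hS'.exists_isGreatest h0
  exact ⟨k, hk, (le_total j k).elim id (hmin ⟨S', hS', hk⟩)⟩

theorem SoundTrail.exists_entailed_of_litLevel_zero (h : SoundTrail prec β N Γ)
    (h0 : LitLevel Γ K 0) : ∃ G ⊆ lits Γ, LitDefined G K ∧ ∀ H ∈ G, Entails N {H} := by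
  rcases h0 with ⟨e, he, rfl, h0⟩ | ⟨-, hK, ⟨i, ⟨S, hS, hi, -⟩, h0⟩ | ⟨hi, -⟩⟩
  · refine ⟨{e.inst}, Set.singleton_subset_iff.2 ⟨e, he, rfl⟩, .inl (litEntails_of_mem rfl), ?_⟩
    rintro _ rfl
    exact h.entails_of_level_eq_zero e he h0
  · refine ⟨subLits Γ S, subLits_subset_lits Γ S, hS.1, ?_⟩
    rintro _ ⟨j, hj, rfl⟩
    have hj0 : (Γ.get j).level = 0 := Nat.le_zero.1 (h0 ▸ h.level_mono (hi.2 hj))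
    exact h.entails_of_level_eq_zero _ (List.get_mem _ _) hj0
  · exact ⟨∅, Set.empty_subset _, not_not.1 fun h0 => hi (exists_isDefining hK h0), by simp⟩

theorem SoundTrail.entails_comp_of_litLevel_zero (h : SoundTrail prec β N Γ)
    (hK : LitFalse (lits Γ) K) (h0 : LitLevel Γ K 0) : Entails N {K.comp} := by
  obtain ⟨G, hG, hdef, hN⟩ := h.exists_entailed_of_litLevel_zero h0
  have hf : LitFalse G K :=
    hdef.resolve_left fun ht => h.consistent.not_true_false (LitEntails.mono ht hG) hK
  exact hf.entails hN

end Levels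

section Chains

variable {c : LitClosure L V} {P : List (RewriteStep L V)} {I : RewriteStep L V}
  [IsTrans (L.Term V) prec] (hctx : ContextClosed prec)
include hctx

theorem SoundTrail.soundClosure_of_chain (h : SoundTrail prec β N Γ)
    (hP : ReductionChain prec (available Γ c) P) (hc : SoundClosure prec β N c) (hI : I ∈ P) :
    SoundClosure prec β N I.closure := by
  refine hP.induction ?_ (fun _ _ _ _ h₁ h₂ => h₁.rewriteInference hctx h₂) I hI
  rintro _ (rfl | ⟨e, he, rfl⟩)
  exacts [hc, h.soundClosure he]

theorem SoundTrail.rest_false_of_chain (h : SoundTrail prec β N Γ)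
    (hP : ReductionChain prec (available Γ c) P) (hc : SoundClosure prec β N c)
    (hf : ClauseFalse (lits Γ) (clauseSubst c.rest c.subst)) (hI : I ∈ P) :
    ClauseFalse (lits Γ) (clauseSubst I.closure.rest I.closure.subst) := by
  refine (hP.induction (Q := fun c => SoundClosure prec β N c ∧
    ClauseFalse (lits Γ) (clauseSubst c.rest c.subst)) ?_ ?_ I hI).2
  · rintro _ (rfl | ⟨e, he, rfl⟩)
    exacts [⟨hc, hf⟩, ⟨h.soundClosure he, h.rest_false he⟩]
  · rintro c₁ c₂ p out ⟨h₁, hf₁⟩ ⟨h₂, hf₂⟩ hout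
    exact ⟨h₁.rewriteInference hctx h₂ hout,
      hout.rest_false h₁.grounding h₂.grounding hf₁ hf₂⟩

end Chains

end Trails

section Entries

variable {L : FirstOrder.Language.{u, 0}} {V : Type v} {prec : L.Term V → L.Term V → Prop}
  {β : L.Term V} {N : Set (Clause L V)} {Γ : Trail L V} {c : LitClosure L V}
  {C₀ C₁ : Clause L V} {K : Lit L V} {σ μ : Subst L V}

theorem clause_eq_add (C : Clause L V) (K : Lit L V) (σ : Subst L V) :
    LitClosure.clause ⟨K, C, σ⟩ = C + {K} := by
  rw [LitClosure.clause, ← Multiset.singleton_add, add_comm]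

theorem soundClosure_add_singleton (hE : Entails N (C₀ + {K})) (hg : Grounding σ (C₀ + {K}))
    (hb : clauseBelow prec (clauseSubst (C₀ + {K}) σ) β) : SoundClosure prec β N ⟨K, C₀, σ⟩ := by
  rw [← clause_eq_add C₀ K σ] at hE hg hb
  exact ⟨hg, hE, hb⟩

theorem soundClosure_factor (hE : Entails N (C₀ + C₁ + {K})) (hg : Grounding σ (C₀ + C₁ + {K}))
    (hμσ : μ.comp σ = σ) (hC₁ : ∀ H ∈ C₁, H.subst μ = K.subst μ)
    (hb : clauseBelow prec (clauseSubst (clauseSubst (C₀ + {K}) μ) σ) β) :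
    SoundClosure prec β N ⟨K.subst μ, clauseSubst C₀ μ, σ⟩ := by
  rw [add_right_comm] at hE hg
  have hE' := hE.factor fun H hH =>
    ⟨K, Multiset.mem_add.2 (.inr (Multiset.mem_singleton_self K)), hC₁ H hH⟩
  have hg' : Grounding σ (clauseSubst (C₀ + {K}) μ) := by
    rw [Grounding, clauseGround, forall_mem_clauseSubst_add] at hg
    rw [Grounding, clauseSubst_clauseSubst, hμσ]
    exact hg.1
  rw [clauseSubst_add, clauseSubst_singleton] at hE' hg' hb
  exact soundClosure_add_singleton hE' hg' hb

theorem ReducesLit.litNormalForm {P : List (RewriteStep L V)} {I : RewriteStep L V}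
    (hP : ReducesLit prec Γ c P) (hI : P.getLast? = some I) :
    LitNormalForm (conv prec (lits Γ)) c.inst I.closure.inst := by
  obtain ⟨-, J, hJ, hnf⟩ := hP
  exact Option.some_injective _ (hI.symm.trans hJ) ▸ hnf

section Appended

variable {P : List (RewriteStep L V)} {I : RewriteStep L V} [IsTrans (L.Term V) prec]
  (hctx : ContextClosed prec)
include hctx

theorem SoundTrail.soundEntry_propagated (h : SoundTrail prec β N Γ) (hc : SoundClosure prec β N c)
    (hu : LitUndefined (lits Γ) c.inst) (hf : ClauseFalse (lits Γ) (clauseSubst c.rest c.subst))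
    (hP : ReducesLit prec Γ c P) (hI : P.getLast? = some I) :
    SoundEntry prec β N Γ ⟨I.closure, lastLevel Γ⟩ where
  closure := h.soundClosure_of_chain hctx hP.1 hc (List.mem_of_getLast? hI)
  undefined := (hP.litNormalForm hI).litUndefined_iff.1 hu
  irreducible := (hP.litNormalForm hI).irreducible
  level := .inr ⟨rfl, h.rest_false_of_chain hctx hP.1 hc hf (List.mem_of_getLast? hI)⟩

theorem SoundTrail.soundEntry_decided (h : SoundTrail prec β N Γ) (hc : SoundClosure prec β N c)
    (hu : LitUndefined (lits Γ) c.inst) (hP : ReducesLit prec Γ c P) (hI : P.getLast? = some I) :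
    SoundEntry prec β N Γ
      ⟨⟨I.closure.lit, {I.closure.lit.comp}, I.closure.subst⟩, lastLevel Γ + 1⟩ where
  closure := (h.soundClosure_of_chain hctx hP.1 hc (List.mem_of_getLast? hI)).tautology
  undefined := (hP.litNormalForm hI).litUndefined_iff.1 hu
  irreducible := (hP.litNormalForm hI).irreducible
  level := .inl ⟨rfl, rfl⟩

end Appended

end Entries

section Conflicts

variable {L : FirstOrder.Language.{u, 0}} {V : Type v} {prec : L.Term V → L.Term V → Prop}
  {β : L.Term V} {N : Set (Clause L V)} {G : Set (Lit L V)} {C D : Clause L V} {σ μ : Subst L V}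

/-- The invariant of a conflict closure `C·σ` under a trail with the ground literals `G`. -/
structure SoundConflict (prec : L.Term V → L.Term V → Prop) (β : L.Term V) (N : Set (Clause L V))
    (G : Set (Lit L V)) (C : Clause L V) (σ : Subst L V) : Prop where
  grounding : Grounding σ C
  bFalse : ClauseBFalse prec β G (clauseSubst C σ)
  entails : Entails N C

theorem SoundConflict.instantiate (h : SoundConflict prec β N G (C + D) σ) (hμσ : μ.comp σ = σ)
    (hE : Entails N (clauseSubst C μ)) : SoundConflict prec β N G (clauseSubst C μ) σ := by
  obtain ⟨hg, ⟨hb, hf⟩, -⟩ := h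
  rw [Grounding, clauseGround, forall_mem_clauseSubst_add] at hg
  rw [clauseBelow_iff, forall_mem_clauseSubst_add] at hb
  rw [ClauseFalse, forall_mem_clauseSubst_add] at hf
  refine ⟨?_, ?_, hE⟩
  · rw [Grounding, clauseSubst_clauseSubst, hμσ]
    exact hg.1
  · rw [clauseSubst_clauseSubst, hμσ]
    exact ⟨clauseBelow_iff.2 hb.1, hf.1⟩

theorem SoundConflict.factorize {b : Bool} {s t s' t' : L.Term V}
    (h : SoundConflict prec β N G (C + {mkLit b s t} + {mkLit b s' t'}) σ)
    (hs : s.subst σ = s'.subst σ) (ht : t.subst σ = t'.subst σ)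
    (hμ : IsMGU μ {(s, s'), (t, t')}) :
    SoundConflict prec β N G (clauseSubst (C + {mkLit b s t}) μ) σ := by
  have hsμ : s.subst μ = s'.subst μ := hμ.unifies (s, s') (.inl rfl)
  have htμ : t.subst μ = t'.subst μ := hμ.unifies (t, t') (.inr rfl)
  refine h.instantiate (hμ.comp_eq ?_) (h.entails.factor fun K hK => ?_)
  · rintro _ (rfl | rfl)
    exacts [hs, ht]
  · refine ⟨mkLit b s t, Multiset.mem_add.2 (.inr (Multiset.mem_singleton_self _)), ?_⟩
    rw [Multiset.mem_singleton.1 hK, mkLit_subst, mkLit_subst, hsμ, htμ]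

theorem entails_refl (s : L.Term V) : Entails N {mkLit true s s} :=
  fun _ _ _ _ _ => ⟨_, Multiset.mem_singleton_self _, holds_mkLit.2 (iff_of_true rfl rfl)⟩

theorem SoundConflict.equalityResolution {s s' : L.Term V}
    (h : SoundConflict prec β N G (C + {mkLit false s s'}) σ) (hs : s.subst σ = s'.subst σ)
    (hμ : IsMGU μ {(s, s')}) : SoundConflict prec β N G (clauseSubst C μ) σ := by
  have hsμ : s.subst μ = s'.subst μ := hμ.unifies (s, s') rfl
  have hE := h.entails.clauseSubst μ
  rw [clauseSubst_add, clauseSubst_singleton, mkLit_subst, ← hsμ] at hE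
  refine h.instantiate (hμ.comp_eq ?_) (hE.resolve_units fun K hK => ?_)
  · rintro _ rfl
    exact hs
  · rw [Multiset.mem_singleton.1 hK]
    exact entails_refl (s.subst μ)

theorem SoundTrail.entails_zero {Γ : Trail L V} (h : SoundTrail prec β N Γ) (hC : C ∈ N)
    (hf : ClauseFalse (lits Γ) (clauseSubst C σ)) (h0 : ClauseLevel Γ (clauseSubst C σ) 0) :
    Entails N 0 := by
  have hE := (entails_of_mem hC).clauseSubst σ
  rw [← zero_add (clauseSubst C σ)] at hE
  refine hE.resolve_units fun K hK => ?_
  obtain ⟨m, hm, hlevel⟩ := h0.1 K hK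
  exact h.entails_comp_of_litLevel_zero (hf K hK) (Nat.le_zero.1 hm ▸ hlevel)

end Conflicts

section States

variable {L : FirstOrder.Language.{u, 0}} {V : Type v} {prec : L.Term V → L.Term V → Prop}
  {β : L.Term V} {N U : Set (Clause L V)} {Γ Γ' : Trail L V} {k : ℕ} {S S' : State L V}

/-- The invariant of the last component of a state whose trail has the ground literals `G`. -/
def SoundStatus (prec : L.Term V → L.Term V → Prop) (β : L.Term V) (N : Set (Clause L V))
    (G : Set (Lit L V)) : Status L V → Prop
  | .top => True
  | .bot => Entails N 0
  | .conflict C σ => SoundConflict prec β N G C σ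

/-- The inductive invariant of runs. In addition to soundness, it asserts that `k` is the level of
the last trail literal and that propagated literals do not change the level. -/
structure Invariant (prec : L.Term V → L.Term V → Prop) (S : State L V) : Prop where
  trail : SoundTrail prec S.β (S.N ∪ S.U) S.Γ
  level : S.k = lastLevel S.Γ
  learned : ∀ C ∈ S.U, Entails S.N C
  status : SoundStatus prec S.β (S.N ∪ S.U) (lits S.Γ) S.D

theorem Invariant.sound (h : Invariant prec S) : Sound prec S where
  consistent := h.trail.consistent
  grounding _ he := (h.trail.soundClosure he).grounding
  propagated Γ₁ e Γ₂ hΓ hd :=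
    have he := h.trail Γ₁ e Γ₂ hΓ
    ⟨⟨he.closure.rest_below, (he.of_not_isDecision hd).2⟩, .inr he.undefined, he.irreducible,
      he.closure.entails, he.closure.below⟩
  decision Γ₁ e Γ₂ hΓ hd :=
    have he := h.trail Γ₁ e Γ₂ hΓ
    ⟨he.of_isDecision hd, .inr he.undefined, he.irreducible, he.closure.entails, he.closure.below⟩
  learned := h.learned
  conflict C σ hD :=
    have hC : SoundStatus prec S.β (S.N ∪ S.U) (lits S.Γ) (.conflict C σ) := hD ▸ h.status
    ⟨hC.grounding, hC.bFalse, hC.entails⟩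
  bot hD := (hD ▸ h.status : SoundStatus prec S.β (S.N ∪ S.U) (lits S.Γ) .bot)

theorem invariant_initialState (N : Set (Clause L V)) (β : L.Term V) :
    Invariant prec (initialState N β) :=
  ⟨soundTrail_nil, rfl, fun _ => False.elim, trivial⟩

theorem Invariant.concat {D : Status L V} (h : Invariant prec ⟨Γ, N, U, β, k, D⟩) {e : AnnLit L V}
    (he : SoundEntry prec β (N ∪ U) Γ e) :
    Invariant prec ⟨Γ ++ [e], N, U, β, e.level, .top⟩ :=
  ⟨soundTrail_concat_iff.2 ⟨h.trail, he⟩, (lastLevel_concat Γ e).symm, h.learned, trivial⟩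

theorem Invariant.skip {e : AnnLit L V} {C : Clause L V} {σ : Subst L V}
    (h : Invariant prec ⟨Γ ++ e :: Γ', N, U, β, k, .conflict C σ⟩)
    (hf : ClauseBFalse prec β (lits (Γ ++ [e])) (clauseSubst C σ)) :
    Invariant prec ⟨Γ ++ [e], N, U, β, e.level, .conflict C σ⟩ where
  trail := (List.append_cons Γ e Γ' ▸ h.trail : SoundTrail _ _ _ (Γ ++ [e] ++ Γ')).of_append
  level := (lastLevel_concat Γ e).symm
  learned := h.learned
  status := { h.status with bFalse := hf }

theorem Invariant.backtrack {e : AnnLit L V} {k' : ℕ} {C : Clause L V} {σ : Subst L V}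
    (h : Invariant prec ⟨Γ ++ e :: Γ', N, U, β, k, .conflict C σ⟩)
    (hk : (IsDecision Γ e ∧ k' + 1 = e.level) ∨ (¬ IsDecision Γ e ∧ k' = e.level)) :
    Invariant prec ⟨Γ, N, U ∪ {C}, β, k', .top⟩ where
  trail := h.trail.of_append.mono (Set.union_subset_union_right N Set.subset_union_left)
  level := hk.elim (fun ⟨hd, hk⟩ => Nat.succ_injective (hk.trans hd)) fun ⟨hd, hk⟩ =>
    hk.trans ((h.trail Γ e Γ' rfl).of_not_isDecision hd).1
  learned D hD := by
    rcases hD with hD | rfl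
    · exact h.learned D hD
    · exact h.status.entails.trans fun D hD => hD.elim entails_of_mem (h.learned D)
  status := trivial

theorem Invariant.propagate [IsStrictOrder (L.Term V) prec] (hctx : ContextClosed prec)
    (h : Invariant prec ⟨Γ, N, U, β, k, .top⟩) {c : LitClosure L V} {P : List (RewriteStep L V)}
    {I : RewriteStep L V} (hc : SoundClosure prec β (N ∪ U) c)
    (hu : LitBUndefined prec β (lits Γ) c.inst)
    (hf : ClauseFalse (lits Γ) (clauseSubst c.rest c.subst))
    (hP : ReducesLit prec Γ c P) (hI : P.getLast? = some I) :
    Invariant prec ⟨Γ ++ [⟨I.closure, k⟩], N, U, β, k, .top⟩ := by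
  obtain rfl : k = lastLevel Γ := h.level
  exact h.concat (h.trail.soundEntry_propagated hctx hc (hu.litUndefined hc.inst_below) hf hP hI)

theorem Invariant.decide [IsStrictOrder (L.Term V) prec] (hctx : ContextClosed prec)
    (h : Invariant prec ⟨Γ, N, U, β, k, .top⟩) {c : LitClosure L V} {P : List (RewriteStep L V)}
    {I : RewriteStep L V} (hc : SoundClosure prec β (N ∪ U) c)
    (hu : LitBUndefined prec β (lits Γ) c.inst)
    (hP : ReducesLit prec Γ c P) (hI : P.getLast? = some I) :
    Invariant prec ⟨Γ ++ [⟨⟨I.closure.lit, {I.closure.lit.comp}, I.closure.subst⟩, k + 1⟩],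
      N, U, β, k + 1, .top⟩ := by
  obtain rfl : k = lastLevel Γ := h.level
  exact h.concat (h.trail.soundEntry_decided hctx hc (hu.litUndefined hc.inst_below) hP hI)

theorem Invariant.step [IsStrictOrder (L.Term V) prec] (hctx : ContextClosed prec)
    (h : Invariant prec S) (hstep : Step prec S S') : Invariant prec S' := by
  cases hstep with
  | @propagate Γ N U β k _ C₀ C₁ K σ μ b s t Q P I hmem hg hC hf hK hC₁ hQ hμ hu hb _ hP hI =>
    subst hC hK hC₁
    have hμσ : μ.comp σ = σ := hμ.comp_eq <| by
      rintro _ ⟨q, hq, rfl | rfl⟩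
      exacts [(hQ q hq).1, (hQ q hq).2]
    have hQμ : ∀ H ∈ Q.map fun q => mkLit b q.1 q.2, H.subst μ = (mkLit b s t).subst μ := by
      refine Multiset.forall_mem_map_iff.2 fun q hq => ?_
      rw [mkLit_subst, mkLit_subst, hμ.unifies (q.1, s) ⟨q, hq, .inl rfl⟩,
        hμ.unifies (q.2, t) ⟨q, hq, .inr rfl⟩]
    refine h.propagate hctx (soundClosure_factor (entails_of_mem hmem) hg hμσ hQμ hb) ?_ ?_ hP.1 hI
    · rwa [LitClosure.inst, Lit.subst_subst, hμσ]
    · rwa [clauseSubst_clauseSubst, hμσ]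
  | decide hmem hg hC _ hu hb _ hP hI =>
    subst hC
    exact h.decide hctx (soundClosure_add_singleton (entails_of_mem hmem) hg hb) hu hP.1 hI
  | conflictBot hmem _ hf _ h0 => exact { h with status := h.trail.entails_zero hmem hf.2 h0 }
  | conflict hmem hg hf => exact { h with status := ⟨hg, hf, entails_of_mem hmem⟩ }
  | skip _ hf => exact h.skip hf
  | @exploreRefutation _ _ _ _ _ C K σ _ _ _ _ _ _ hP hI _ hf =>
    obtain ⟨hg, ⟨hb, -⟩, hE⟩ := h.status
    have hI := h.trail.soundClosure_of_chain hctx hP.2.1.1 (soundClosure_add_singleton hE hg hb) hI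
    exact { h with status := ⟨hI.grounding, hf, hI.entails⟩ }
  | factorize hs ht hμ => exact { h with status := h.status.factorize hs ht hμ }
  | equalityResolution hs hμ => exact { h with status := h.status.equalityResolution hs hμ }
  | backtrack _ _ _ _ hk => exact h.backtrack hk
  | grow => exact ⟨soundTrail_nil, rfl, h.learned, trivial⟩

end States

theorem IsDesired.isStrictOrder {L : FirstOrder.Language.{u, 0}} {V : Type v}
    {prec : L.Term V → L.Term V → Prop} (h : IsDesired prec) : IsStrictOrder (L.Term V) prec where
  irrefl := h.irrefl
  trans := h.trans

end SCLEQ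

theorem mainTheorem2_general {L : FirstOrder.Language.{u, 0}} {V : Type v}
    (prec : L.Term V → L.Term V → Prop) [IsStrictOrder (L.Term V) prec]
    (hctx : SCLEQ.ContextClosed prec) (N : Set (SCLEQ.Clause L V)) (β : L.Term V)
    (S : SCLEQ.State L V) (hS : SCLEQ.ResultsFromRun prec N β S) : SCLEQ.Sound prec S := by
  have h : SCLEQ.Invariant prec S := by
    induction hS with
    | refl => exact SCLEQ.invariant_initialState N β
    | tail _ hstep ih => exact ih.step hctx hstep
  exact h.sound

theorem mainTheorem2 {L : FirstOrder.Language.{u, 0}} [L.IsAlgebraic] {V : Type v} [Infinite V]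
    (prec : L.Term V → L.Term V → Prop) (hprec : SCLEQ.IsDesired prec)
    (N : Set (SCLEQ.Clause L V)) (β : L.Term V) (hβ : SCLEQ.IsGround β)
    (S : SCLEQ.State L V) (hS : SCLEQ.ResultsFromRun prec N β S) :
    SCLEQ.Sound prec S := by
  have := hprec.isStrictOrder
  exact mainTheorem2_general prec (fun _ => hprec.context) N β S hS
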